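/- Let $\mathrm{SU}(2)\cong S^3$, let $D=\mathrm{SU}(2)\times\mathrm{SU}(2)$, and let $$\mathcal O_{(x,y)}=\{(w x z^{-1},\, z y w^{-1}) : w,z\in \mathrm{SU}(2)\}\subset D$$ be the twisted conjugacy class of $(x,y)\in D$, i.e. its orbit under the twisted adjoint action of $D$ on itself determined by the automorphism $\tau(x,y)=(y,x)$. Write $H_n$ for singular homology with integer coefficients, $i:\mathcal O\hookrightarrow D$ for the inclusion of a class, and $\mathrm{pr}_1,\mathrm{pr}_2:D\to\mathrm{SU}(2)$ for the two projections. For a connected closed $n$-manifold $M$, a fundamental class is a generator of $H_n(M)\cong\mathbb Z$ (one for each of the two orientations of $M$). Then: 1. $H_3(\mathrm{SU}(2))\cong\mathbb Z$. Every twisted conjugacy class $\mathcal O$ that is a $3$-dimensional submanifold has a fundamental class $[\mathcal O]\in H_3(\mathcal O)$ (that is, $H_3(\mathcal O)\cong\mathbb Z$), and it is homologically nontrivial: $i_*[\mathcal O]\neq 0$ in $H_3(D)$ for each of its fundamental classes. More precisely, for each fundamental class and under any isomorphism $H_3(\mathrm{SU}(2))\cong\mathbb Z$, the elements $(\mathrm{pr}_1)_*i_*[\mathcal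 O]$ and $(\mathrm{pr}_2)_*i_*[\mathcal O]$ are $1$ and $-1$, or $-1$ and $1$, respectively. 2. $H_5(D)=0$. Every twisted conjugacy class $\mathcal O$ that is a $5$-dimensional submanifold has a fundamental class $[\mathcal O]\in H_5(\mathcal O)\cong\mathbb Z$, and it is homologically trivial: $i_*[\mathcal O]=0$ for each of its fundamental classes. It is not homotopically trivial: the inclusion $i:\mathcal O\to D$ is not homotopic to a constant map. -/

import Mathlib

open scoped ContDiff

/-- The twisted adjoint action of `D = G × G` on itself determined by the twist
`τ (x, y) = (y, x)`, that is `g • p = g * p * (τ g)⁻¹`. -/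
def twistedAd {G : Type*} [Group G] (g p : G × G) : G × G :=
  (g.1 * p.1 * g.2⁻¹, g.2 * p.2 * g.1⁻¹)

/-- The twisted conjugacy class of `p`: its orbit under the twisted adjoint action. -/
def twistedClass {G : Type*} [Group G] (p : G × G) : Set (G × G) :=
  Set.range fun g : G × G => twistedAd g p

/-- The group `SU(2)`, with the topology induced from the complex `2 × 2` matrices. -/
abbrev SU2 : Type := Matrix.specialUnitaryGroup (Fin 2) ℂ

/-- `S` is an embedded smooth submanifold of dimension `d` of the finite-dimensional real vector
space `V`: near each of its points there is a diffeomorphism between open subsets of `V` that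
carries `S` onto a `d`-dimensional linear subspace. -/
def IsSmoothSubmanifold {V : Type*} [NormedAddCommGroup V] [NormedSpace ℝ V]
    [FiniteDimensional ℝ V] (d : ℕ) (S : Set V) : Prop :=
  ∀ p ∈ S, ∃ (e : OpenPartialHomeomorph V V) (L : Submodule ℝ V),
    p ∈ e.source ∧ ContDiffOn ℝ ∞ e e.source ∧ ContDiffOn ℝ ∞ e.symm e.target ∧
      Module.finrank ℝ L = d ∧ ∀ q ∈ e.source, (q ∈ S ↔ e q ∈ L)

/-- The standard embedding of `SU(2) × SU(2)` into the real vector space of pairs of complex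
`2 × 2` arrays. -/
def su2ProdEmb (p : SU2 × SU2) : (Fin 2 → Fin 2 → ℂ) × (Fin 2 → Fin 2 → ℂ) :=
  (fun i j => (p.1 : Matrix (Fin 2) (Fin 2) ℂ) i j,
    fun i j => (p.2 : Matrix (Fin 2) (Fin 2) ℂ) i j)

/-- `S ⊆ SU(2) × SU(2)` is an embedded smooth submanifold of dimension `d`. Since
`SU(2) × SU(2)` is itself embedded in the space of pairs of matrices, this can be tested there. -/
def HasDim (d : ℕ) (S : Set (SU2 × SU2)) : Prop :=
  IsSmoothSubmanifold d (su2ProdEmb '' S)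

noncomputable section

/-- Singular homology `H_n(X; ℤ)`. -/
abbrev Homology (n : ℕ) (X : Type) [TopologicalSpace X] : ModuleCat.{0} ℤ :=
  ((AlgebraicTopology.singularHomologyFunctor (ModuleCat.{0} ℤ) n).obj (ModuleCat.of ℤ ℤ)).obj
    (TopCat.of X)

/-- The map `f_* : H_n(X; ℤ) → H_n(Y; ℤ)` induced by a continuous map `f`. -/
def Homology.map (n : ℕ) {X Y : Type} [TopologicalSpace X] [TopologicalSpace Y] (f : C(X, Y)) :
    Homology n X →ₗ[ℤ] Homology n Y :=
  (((AlgebraicTopology.singularHomologyFunctor (ModuleCat.{0} ℤ) n).obj (ModuleCat.of ℤ ℤ)).map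
    (TopCat.ofHom f)).hom

/-- A fundamental class of a connected closed `n`-manifold `M`: a free generator of
`H_n(M; ℤ)`. If `M` is orientable there are two of them, one for each orientation; if it is not,
there is none. -/
def IsFundamentalClass (n : ℕ) {M : Type} [TopologicalSpace M] (c : Homology n M) : Prop :=
  Function.Bijective fun k : ℤ => k • c

/-- The inclusion of a subspace. -/
def incl {X : Type} [TopologicalSpace X] (S : Set X) : C(S, X) :=
  ⟨Subtype.val, continuous_subtype_val⟩

end

set_option linter.unusedSectionVars false


/-! The components of a point $(a,b)$ of the class of $(x,y)$ satisfy: $ab$ is conjugate to $c=xy$,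
and this condition describes the class (`SU2.mem_twistedClass_iff`). Everything depends on whether
$c$ is central.

If $c$ is central, the class is the graph of $a\mapsto a^{-1}c$. The first projection is a
homeomorphism onto $\mathrm{SU}(2)\cong S^3$, and the second is inversion followed by a right
translation. The translation acts trivially on homology because $\mathrm{SU}(2)$ is path connected,
and inversion acts on $H_3$ by $-1$ (`SU2.map_inv`), which gives the signs.

If $c$ is not central, $(a,b)\mapsto(a,ab)$ identifies the class with $\mathrm{SU}(2)$ times the
conjugacy class of $c$. The latter is the 2-sphere of unit quaternions with the real part of $c$
(`SU2.isConj_of_coord_eq`). So the class is homotopy equivalent to $\mathrm{SU}(2)\times(\mathbb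
R^3\setminus 0)$ and its $H_5$ is $\mathbb Z$, whereas $H_5(D)=0$. In both cases
$a\mapsto(a,a^{-1}c)$ is a section of the first projection. A nullhomotopic inclusion would
therefore force $H_3(\mathrm{SU}(2))=0$ (`SU2.not_nullhomotopic`).

The dimension decides which case holds. A central class lies in a 4-dimensional linear subspace, so
its dimension is not 5 (`SU2.dim_le_of_central`). A non-central class has four independent tangent
vectors at one point, so its dimension is not 3 (`SU2.le_dim_of_not_central`).

The homology groups come from Mayer-Vietoris, which is proved by barycentric subdivision. In place
of reduced homology and the Künneth formula, the kernel of $H_n(X\times P)\to H_n(X)$ is used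
(`Homology.fibreKer`). For $P=\mathbb R^{k}\setminus 0$ it is shifted by suspension and finally
identified with a homology group of $X$. -/

/-! ### Singular chains as finitely supported functions on singular simplices -/

/-- The morphism `ℤ ⟶ M` with value `m` at `1`. -/
def ModuleCat.ofElement {M : ModuleCat.{0} ℤ} (m : M) : ModuleCat.of ℤ ℤ ⟶ M :=
  ModuleCat.ofHom (LinearMap.toSpanSingleton ℤ M m)

@[simp]
lemma ModuleCat.ofElement_one {M : ModuleCat.{0} ℤ} (m : M) :
    (ModuleCat.ofElement m).hom (1 : ℤ) = m :=
  LinearMap.toSpanSingleton_apply_one ℤ M m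

lemma ModuleCat.int_hom_ext {M : ModuleCat.{0} ℤ} {f g : ModuleCat.of ℤ ℤ ⟶ M}
    (h : f.hom (1 : ℤ) = g.hom (1 : ℤ)) : f = g :=
  ModuleCat.hom_ext (LinearMap.ext_ring h)

open CategoryTheory Limits in
/-- The coproduct of copies of `ℤ` is the free abelian group. -/
noncomputable def sigmaConstIsoFree :
    (sigmaConst.obj (ModuleCat.of ℤ ℤ) : Type ⥤ ModuleCat.{0} ℤ) ≅ ModuleCat.free ℤ :=
  NatIso.ofComponents
    (fun T =>
      { hom := (Sigma.desc fun x : T => ModuleCat.ofElement (ModuleCat.freeMk x) :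
          (∐ fun _ : T => ModuleCat.of ℤ ℤ) ⟶ (ModuleCat.free ℤ).obj T)
        inv := (ModuleCat.freeDesc
          (↾fun x => (Sigma.ι (fun _ : T => ModuleCat.of ℤ ℤ) x).hom (1 : ℤ)) :
          (ModuleCat.free ℤ).obj T ⟶ (∐ fun _ : T => ModuleCat.of ℤ ℤ))
        hom_inv_id := by
          refine Sigma.hom_ext _ _ fun x => ?_
          rw [Sigma.ι_desc_assoc]
          refine ModuleCat.int_hom_ext ?_
          exact (congrArg _ (ModuleCat.ofElement_one _)).trans (ModuleCat.freeDesc_apply _ x)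
        inv_hom_id := by
          ext x
          have := Sigma.ι_desc (fun x : T => ModuleCat.ofElement (ModuleCat.freeMk x)) x
          have h2 := congrArg (fun f => f.hom (1 : ℤ)) this
          refine (congrArg _ (ModuleCat.freeDesc_apply _ x)).trans ?_
          exact h2.trans (ModuleCat.ofElement_one _) })
    (fun {T T'} f => by
      refine Sigma.hom_ext _ _ fun x => ?_
      have h1 : Sigma.ι (fun _ : T => ModuleCat.of ℤ ℤ) x ≫
          (sigmaConst.obj (ModuleCat.of ℤ ℤ)).map f =
            Sigma.ι (fun _ : T' => ModuleCat.of ℤ ℤ) (f x) := by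
        simp [sigmaConst]
      rw [reassoc_of% h1]
      simp only [Sigma.ι_desc, Sigma.ι_desc_assoc]
      refine ModuleCat.int_hom_ext ?_
      refine (ModuleCat.ofElement_one _).trans (Eq.symm ?_)
      exact (congrArg _ (ModuleCat.ofElement_one _)).trans (ModuleCat.free_map_apply f x))

/-- The standard topological simplex. -/
abbrev TopSimplex (n : ℕ) : Type := stdSimplex ℝ (Fin (n + 1))

open CategoryTheory in
/-- The singular simplicial set of a space, with simplices continuous maps from
standard simplices. -/
noncomputable def singularSet : TopCat.{0} ⥤ SSet.{0} where
  obj X :=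
    { obj := fun n => C(stdSimplex ℝ (Fin (n.unop.len + 1)), X)
      map := fun f => ↾fun σ => σ.comp ⟨_, stdSimplex.continuous_map f.unop⟩
      map_id := fun n => by
        ext σ t
        have h : stdSimplex.map (ConcreteCategory.hom (𝟙 n : n ⟶ n).unop) t = t := by
          simp
        exact congrArg σ h
      map_comp := fun f g => by
        ext σ t
        have h : stdSimplex.map (ConcreteCategory.hom (f ≫ g).unop) t =
            stdSimplex.map (ConcreteCategory.hom f.unop)
              (stdSimplex.map (ConcreteCategory.hom g.unop) t) := by
          simp [stdSimplex.map_comp_apply]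
          rfl
        exact congrArg σ h }
  map f := { app := fun n => ↾fun σ => f.hom.comp σ }

-- Simplices are described here directly by barycentric coordinates, which makes explicit affine
-- formulas available. The two structures agree definitionally.
open CategoryTheory in
noncomputable def toSSetIsoSingularSet : TopCat.toSSet.{0} ≅ singularSet :=
  NatIso.ofComponents (fun X => NatIso.ofComponents (fun n => (X.toSSetObjEquiv n).toIso)
    (fun f => by
      ext σ
      rfl))
    (fun f => by
      ext n σ
      rfl)

-- The degree `n` module unfolds to `C(TopSimplex n, X) →₀ ℤ`, so that statements about
-- `SingularChain` apply to this complex by `rfl`.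
open CategoryTheory AlgebraicTopology in
noncomputable def chainsFunctor : TopCat.{0} ⥤ ChainComplex (ModuleCat.{0} ℤ) ℕ :=
  singularSet ⋙ ((SimplicialObject.whiskering _ _).obj (ModuleCat.free ℤ)) ⋙
    alternatingFaceMapComplex _

open CategoryTheory AlgebraicTopology Limits in
noncomputable def singularChainComplexIso :
    (singularChainComplexFunctor (ModuleCat.{0} ℤ)).obj (ModuleCat.of ℤ ℤ) ≅ chainsFunctor :=
  Functor.isoWhiskerRight toSSetIsoSingularSet
    ((SimplicialObject.whiskering _ _).obj (sigmaConst.obj (ModuleCat.of ℤ ℤ)) ⋙ 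
       alternatingFaceMapComplex _) ≪≫
    Functor.isoWhiskerLeft singularSet
      (Functor.isoWhiskerRight ((SimplicialObject.whiskering _ _).mapIso sigmaConstIsoFree)
        (alternatingFaceMapComplex _))

open CategoryTheory AlgebraicTopology Limits in
noncomputable def homologyIso (n : ℕ) (X : Type) [TopologicalSpace X] :
    Homology n X ≅ (chainsFunctor.obj (TopCat.of X)).homology n :=
  (HomologicalComplex.homologyFunctor _ _ n).mapIso (singularChainComplexIso.app (TopCat.of X))

open CategoryTheory in
lemma homologyIso_naturality (n : ℕ) {X Y : Type} [TopologicalSpace X] [TopologicalSpace Y]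
    (f : C(X, Y)) (z : Homology n X) :
    (homologyIso n Y).hom (Homology.map n f z) =
      HomologicalComplex.homologyMap (chainsFunctor.map (TopCat.ofHom f)) n
        ((homologyIso n X).hom z) := by
  have := (HomologicalComplex.homologyFunctor _ _ n).congr_map
    (singularChainComplexIso.hom.naturality (TopCat.ofHom f))
  rw [Functor.map_comp, Functor.map_comp] at this
  exact congrArg (fun g => g.hom z) this

/-- Singular chains. -/
abbrev SingularChain (n : ℕ) (X : Type) [TopologicalSpace X] : Type := C(TopSimplex n, X) →₀ ℤ

/-- The `i`-th face of the standard simplex. -/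
noncomputable def faceMap {n : ℕ} (i : Fin (n + 2)) : C(TopSimplex n, TopSimplex (n + 1)) :=
  ⟨_, stdSimplex.continuous_map i.succAbove⟩

namespace SingularChain

variable {X Y : Type} [TopologicalSpace X] [TopologicalSpace Y]

/-- The boundary operator on singular chains. -/
noncomputable def boundary (n : ℕ) (X : Type) [TopologicalSpace X] :
    SingularChain (n + 1) X →ₗ[ℤ] SingularChain n X :=
  ∑ i : Fin (n + 2), (-1 : ℤ) ^ (i : ℕ) • Finsupp.lmapDomain ℤ ℤ fun σ => σ.comp (faceMap i)

/-- The map on chains induced by a continuous map. -/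
noncomputable def map (n : ℕ) (f : C(X, Y)) : SingularChain n X →ₗ[ℤ] SingularChain n Y :=
  Finsupp.lmapDomain ℤ ℤ fun σ => f.comp σ

end SingularChain

lemma chainsFunctor_obj_d (n : ℕ) (X : TopCat.{0}) :
    (chainsFunctor.obj X).d (n + 1) n = ModuleCat.ofHom (SingularChain.boundary n X) := by
  refine (AlgebraicTopology.alternatingFaceMapComplex_obj_d _ n).trans ?_
  refine ModuleCat.hom_ext ?_
  simp only [AlgebraicTopology.AlternatingFaceMapComplex.objD]
  rw [ModuleCat.hom_sum]
  rfl

/-! ### Cones and subdivision of formal ordered simplices -/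

/-- Formal chains on ordered simplices with vertices in a type. -/
abbrev OrdChain (k : ℕ) (V : Type*) : Type _ := (Fin (k + 1) → V) →₀ ℤ

namespace OrdChain

variable {V W : Type*}

/-- The boundary operator on ordered simplices. -/
noncomputable def boundary (k : ℕ) (V : Type*) : OrdChain (k + 1) V →ₗ[ℤ] OrdChain k V :=
  ∑ i : Fin (k + 2), (-1 : ℤ) ^ (i : ℕ) • Finsupp.lmapDomain ℤ ℤ fun v => v ∘ i.succAbove

/-- The cone with apex `b`. -/
noncomputable def cone (k : ℕ) (b : V) : OrdChain k V →ₗ[ℤ] OrdChain (k + 1) V :=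
  Finsupp.lmapDomain ℤ ℤ fun v => Fin.cons b v

/-- The map induced by a map of vertices. -/
noncomputable def map (k : ℕ) (f : V → W) : OrdChain k V →ₗ[ℤ] OrdChain k W :=
  Finsupp.lmapDomain ℤ ℤ fun v => f ∘ v

/-- The augmentation. -/
noncomputable def aug (V : Type*) : OrdChain 0 V →ₗ[ℤ] ℤ :=
  Finsupp.linearCombination ℤ fun _ => 1

lemma boundary_single {k : ℕ} (v : Fin (k + 2) → V) :
    boundary k V (Finsupp.single v 1) =
      ∑ i : Fin (k + 2), (-1 : ℤ) ^ (i : ℕ) • Finsupp.single (v ∘ i.succAbove) 1 := by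
  simp [boundary, Finsupp.mapDomain_single]

@[simp]
lemma cone_single {k : ℕ} (b : V) (v : Fin (k + 1) → V) :
    cone k b (Finsupp.single v 1) = Finsupp.single (Fin.cons b v : Fin (k + 2) → V) 1 := by
  simp [cone, Finsupp.mapDomain_single]

@[simp]
lemma map_single {k : ℕ} (f : V → W) (v : Fin (k + 1) → V) :
    map k f (Finsupp.single v 1) = Finsupp.single (f ∘ v) 1 := by
  simp [map, Finsupp.mapDomain_single]

lemma hom_ext {k : ℕ} {M : Type*} [AddCommGroup M] {f g : OrdChain k V →ₗ[ℤ] M}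
    (h : ∀ v, f (Finsupp.single v 1) = g (Finsupp.single v 1)) : f = g :=
  Finsupp.lhom_ext' fun v => LinearMap.ext_ring (h v)

lemma cons_comp_succAbove_succ {k : ℕ} (b : V) (v : Fin (k + 2) → V) (i : Fin (k + 2)) :
    (Fin.cons b v : Fin (k + 3) → V) ∘ i.succ.succAbove = Fin.cons b (v ∘ i.succAbove) := by
  ext j
  cases j using Fin.cases <;> simp

/-- Deleting the apex gives back the base; deleting any other vertex gives the cone over a face,
with the sign shifted by one. -/
lemma boundary_cone {k : ℕ} (b : V) (c : OrdChain (k + 1) V) :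
    boundary (k + 1) V (cone (k + 1) b c) = c - cone k b (boundary k V c) := by
  suffices h : boundary (k + 1) V ∘ₗ cone (k + 1) b = LinearMap.id - cone k b ∘ₗ boundary k V from
    LinearMap.congr_fun h c
  refine hom_ext fun v => ?_
  simp only [LinearMap.comp_apply, LinearMap.sub_apply, LinearMap.id_apply, cone_single,
    boundary_single, map_sum, map_smul, Fin.sum_univ_succ (n := k + 2)]
  have : (Fin.cons b v : Fin (k + 3) → V) ∘ (0 : Fin (k + 3)).succAbove = v := by
    ext j; simp
  rw [this, sub_eq_add_neg, ← Finset.sum_neg_distrib]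
  congr 1
  · simp
  · refine Finset.sum_congr rfl fun i _ => ?_
    rw [cons_comp_succAbove_succ, Fin.val_succ, pow_succ]
    simp

/-- In the lowest degree the faces of the base are empty, so the apex itself appears, weighted by
the augmentation. -/
lemma boundary_cone_zero (b : V) (c : OrdChain 0 V) :
    boundary 0 V (cone 0 b c) = c - aug V c • Finsupp.single (fun _ => b) 1 := by
  suffices h : boundary 0 V ∘ₗ cone 0 b =
      LinearMap.id - (aug V).smulRight (Finsupp.single (fun _ => b) 1) from
    LinearMap.congr_fun h c
  refine hom_ext fun v => ?_
  have h1 : (Fin.cons b v : Fin 2 → V) ∘ (1 : Fin 2).succAbove = fun _ => b := by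
    ext j
    rw [Subsingleton.elim j 0]
    rfl
  simp [boundary_single, Fin.sum_univ_two, h1, aug, sub_eq_add_neg]

lemma aug_boundary (c : OrdChain 1 V) : aug V (boundary 0 V c) = 0 := by
  suffices h : aug V ∘ₗ boundary 0 V = 0 from LinearMap.congr_fun h c
  refine hom_ext fun v => ?_
  simp [boundary_single, Fin.sum_univ_two, aug]

lemma single_eq_cone {k : ℕ} (v : Fin (k + 2) → V) :
    Finsupp.single v (1 : ℤ) = cone k (v 0) (Finsupp.single (Fin.tail v) 1) := by
  rw [cone_single, Fin.cons_self_tail]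

/-- Every ordered simplex is the cone from its first vertex over the rest, so induction on the
degree and the cone formula suffice. -/
lemma boundary_boundary : ∀ {k : ℕ} (c : OrdChain (k + 2) V),
    boundary k V (boundary (k + 1) V c) = 0 := by
  suffices h : ∀ k, boundary k V ∘ₗ boundary (k + 1) V = 0 from
    fun {k} c => LinearMap.congr_fun (h k) c
  intro k
  induction k with
  | zero =>
    refine hom_ext fun v => ?_
    rw [single_eq_cone, LinearMap.comp_apply, boundary_cone, map_sub, boundary_cone_zero,
      aug_boundary]
    simp
  | succ k ih =>
    refine hom_ext fun v => ?_
    rw [single_eq_cone, LinearMap.comp_apply, boundary_cone, map_sub, boundary_cone,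
      ← LinearMap.comp_apply (boundary k V), ih]
    simp

lemma boundary_map {k : ℕ} (f : V → W) (c : OrdChain (k + 1) V) :
    boundary k W (map (k + 1) f c) = map k f (boundary k V c) := by
  suffices h : boundary k W ∘ₗ map (k + 1) f = map k f ∘ₗ boundary k V from
    LinearMap.congr_fun h c
  refine hom_ext fun v => ?_
  simp only [LinearMap.comp_apply, map_single, boundary_single, map_sum, map_smul,
    Function.comp_assoc]

lemma map_cone {k : ℕ} (f : V → W) (b : V) (c : OrdChain k V) :
    map (k + 1) f (cone k b c) = cone k (f b) (map k f c) := by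
  suffices h : map (k + 1) f ∘ₗ cone k b = cone k (f b) ∘ₗ map k f from
    LinearMap.congr_fun h c
  refine hom_ext fun v => ?_
  simp [Fin.comp_cons]

section Subdivision

variable (β : ∀ k : ℕ, (Fin (k + 1) → V) → V) (γ : ∀ k : ℕ, (Fin (k + 1) → W) → W)

/-- The subdivision operator obtained by coning off from the points `β`. -/
noncomputable def subdiv : ∀ k : ℕ, OrdChain k V →ₗ[ℤ] OrdChain k V
  | 0 => LinearMap.id
  | k + 1 => Finsupp.linearCombination ℤ fun v =>
      cone k (β (k + 1) v) (subdiv k (boundary k V (Finsupp.single v 1)))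

/-- The chain homotopy between the identity and the subdivision operator. -/
noncomputable def subdivHomotopy : ∀ k : ℕ, OrdChain k V →ₗ[ℤ] OrdChain (k + 1) V
  | 0 => 0
  | k + 1 => Finsupp.linearCombination ℤ fun v =>
      cone (k + 1) (β (k + 1) v) (Finsupp.single v 1 - subdiv β (k + 1) (Finsupp.single v 1) -
        subdivHomotopy k (boundary k V (Finsupp.single v 1)))

lemma subdiv_zero_apply (c : OrdChain 0 V) : subdiv β 0 c = c := rfl

lemma subdivHomotopy_zero_apply (c : OrdChain 0 V) : subdivHomotopy β 0 c = 0 := rfl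

lemma subdiv_single_succ {k : ℕ} (v : Fin (k + 2) → V) :
    subdiv β (k + 1) (Finsupp.single v 1) =
      cone k (β (k + 1) v) (subdiv β k (boundary k V (Finsupp.single v 1))) := by
  simp [subdiv]

lemma subdivHomotopy_single_succ {k : ℕ} (v : Fin (k + 2) → V) :
    subdivHomotopy β (k + 1) (Finsupp.single v 1) =
      cone (k + 1) (β (k + 1) v) (Finsupp.single v 1 - subdiv β (k + 1) (Finsupp.single v 1) -
        subdivHomotopy β k (boundary k V (Finsupp.single v 1))) := by
  simp [subdivHomotopy]

/-- The subdivision of a simplex is the cone over its subdivided boundary. The cone formula leaves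
that boundary plus a term that vanishes by induction and $\partial\partial=0$. -/
lemma boundary_subdiv : ∀ {k : ℕ} (c : OrdChain (k + 1) V),
    boundary k V (subdiv β (k + 1) c) = subdiv β k (boundary k V c) := by
  suffices h : ∀ k, boundary k V ∘ₗ subdiv β (k + 1) = subdiv β k ∘ₗ boundary k V from
    fun {k} c => LinearMap.congr_fun (h k) c
  intro k
  induction k with
  | zero =>
    refine hom_ext fun v => ?_
    rw [LinearMap.comp_apply, LinearMap.comp_apply, subdiv_single_succ, boundary_cone_zero]
    simp [subdiv, aug_boundary]
  | succ k ih =>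
    refine hom_ext fun v => ?_
    rw [LinearMap.comp_apply, LinearMap.comp_apply, subdiv_single_succ, boundary_cone,
      ← LinearMap.comp_apply (boundary k V), ih, LinearMap.comp_apply, boundary_boundary]
    simp

/-- The chain that is coned off in the definition is a cycle, by induction, so the boundary of its
cone is that chain itself. -/
lemma boundary_subdivHomotopy : ∀ {k : ℕ} (c : OrdChain (k + 1) V),
    boundary (k + 1) V (subdivHomotopy β (k + 1) c) =
      c - subdiv β (k + 1) c - subdivHomotopy β k (boundary k V c) := by
  suffices h : ∀ k, boundary (k + 1) V ∘ₗ subdivHomotopy β (k + 1) =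
      LinearMap.id - subdiv β (k + 1) - subdivHomotopy β k ∘ₗ boundary k V from
    fun {k} c => LinearMap.congr_fun (h k) c
  intro k
  induction k with
  | zero =>
    refine hom_ext fun v => ?_
    rw [LinearMap.comp_apply, subdivHomotopy_single_succ, boundary_cone]
    simp only [map_sub, boundary_subdiv, subdiv_zero_apply, subdivHomotopy_zero_apply, map_zero,
      LinearMap.sub_apply, LinearMap.id_apply, LinearMap.comp_apply, sub_self, sub_zero]
  | succ k ih =>
    refine hom_ext fun v => ?_
    have h := LinearMap.congr_fun ih (boundary (k + 1) V (Finsupp.single v 1))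
    simp only [LinearMap.comp_apply, LinearMap.sub_apply, LinearMap.id_apply,
      boundary_boundary, map_zero, sub_zero] at h
    rw [LinearMap.comp_apply, subdivHomotopy_single_succ, boundary_cone]
    simp [boundary_subdiv, h]

variable {β γ}

/-- Naturality under maps compatible with the chosen cone points. Affine maps preserve barycenters,
which makes it applicable to them. -/
lemma map_subdiv {f : V → W} (hf : ∀ k v, f (β k v) = γ k (f ∘ v)) : ∀ {k : ℕ} (c : OrdChain k V),
    map k f (subdiv β k c) = subdiv γ k (map k f c) := by
  suffices h : ∀ k, map k f ∘ₗ subdiv β k = subdiv γ k ∘ₗ map k f from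
    fun {k} c => LinearMap.congr_fun (h k) c
  intro k
  induction k with
  | zero => rfl
  | succ k ih =>
    refine hom_ext fun v => ?_
    rw [LinearMap.comp_apply, LinearMap.comp_apply, map_single, subdiv_single_succ,
      subdiv_single_succ, map_cone, ← LinearMap.comp_apply (map k f), ih, hf, ← map_single,
      boundary_map, LinearMap.comp_apply]

lemma map_subdivHomotopy {f : V → W} (hf : ∀ k v, f (β k v) = γ k (f ∘ v)) :
    ∀ {k : ℕ} (c : OrdChain k V),
      map (k + 1) f (subdivHomotopy β k c) = subdivHomotopy γ k (map k f c) := by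
  suffices h : ∀ k, map (k + 1) f ∘ₗ subdivHomotopy β k = subdivHomotopy γ k ∘ₗ map k f from
    fun {k} c => LinearMap.congr_fun (h k) c
  intro k
  induction k with
  | zero => simp [subdivHomotopy]
  | succ k ih =>
    refine hom_ext fun v => ?_
    have h := LinearMap.congr_fun ih (boundary k V (Finsupp.single v 1))
    simp only [LinearMap.comp_apply, ← boundary_map, map_single] at h
    simp only [LinearMap.comp_apply, map_single, subdivHomotopy_single_succ, map_cone, map_sub,
      h, hf, map_subdiv hf]

end Subdivision

end OrdChain

/-! ### Affine simplices and the barycenter estimate -/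

/-- The affine map between standard simplices with prescribed values at the vertices. -/
noncomputable def affineSimplex {k n : ℕ} (v : Fin (k + 1) → TopSimplex n) :
    C(TopSimplex k, TopSimplex n) where
  toFun t := ⟨∑ i, t i • (v i : Fin (n + 1) → ℝ),
    (convex_stdSimplex ℝ _).sum_mem (fun i _ => t.2.1 i) t.2.2 fun i _ => (v i).2⟩
  continuous_toFun := by
    refine Continuous.subtype_mk ?_ _
    refine continuous_finsetSum _ fun i _ => ?_
    exact ((continuous_apply i).comp continuous_subtype_val).smul continuous_const

namespace TopSimplex

lemma affineSimplex_coe {k n : ℕ} (v : Fin (k + 1) → TopSimplex n) (t : TopSimplex k) :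
    (affineSimplex v t).1 = ∑ i, t i • (v i).1 := rfl

lemma affineSimplex_apply {k n : ℕ} (v : Fin (k + 1) → TopSimplex n) (t : TopSimplex k)
    (j : Fin (n + 1)) : affineSimplex v t j = ∑ i, t i * v i j := by
  change (∑ i, t i • (v i).1) j = _
  simp only [Finset.sum_apply, Pi.smul_apply, smul_eq_mul]
  rfl

/-- The barycenter of a tuple of points. -/
noncomputable def bary (n k : ℕ) (v : Fin (k + 1) → TopSimplex n) : TopSimplex n :=
  affineSimplex v stdSimplex.barycenter

/-- The vertices of the standard simplex. -/
noncomputable def vertices (n : ℕ) (i : Fin (n + 1)) : TopSimplex n := stdSimplex.vertex i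

lemma affineSimplex_comp {k n m : ℕ} (u : Fin (n + 1) → TopSimplex m)
    (v : Fin (k + 1) → TopSimplex n) :
    (affineSimplex u).comp (affineSimplex v) = affineSimplex (affineSimplex u ∘ v) := by
  refine ContinuousMap.ext fun t => stdSimplex.ext (funext fun j => ?_)
  simp only [ContinuousMap.comp_apply, affineSimplex_apply, Function.comp_apply, Finset.sum_mul,
    Finset.mul_sum, mul_assoc]
  exact Finset.sum_comm

lemma vertices_apply (n : ℕ) (i j : Fin (n + 1)) :
    vertices n i j = (Pi.single i 1 : Fin (n + 1) → ℝ) j := rfl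

lemma affineSimplex_vertices (n : ℕ) : affineSimplex (vertices n) = ContinuousMap.id _ := by
  refine ContinuousMap.ext fun t => stdSimplex.ext (funext fun j => ?_)
  simp [affineSimplex_apply, vertices_apply, Pi.single_apply]

lemma affineSimplex_comp_vertices {k n : ℕ} (v : Fin (k + 1) → TopSimplex n) :
    affineSimplex v ∘ vertices k = v := by
  funext i
  refine stdSimplex.ext (funext fun j => ?_)
  simp [affineSimplex_apply, vertices_apply, Pi.single_apply]

lemma faceMap_eq {n : ℕ} (i : Fin (n + 2)) :
    faceMap i = affineSimplex (vertices (n + 1) ∘ i.succAbove) := by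
  refine ContinuousMap.ext fun t => stdSimplex.ext (funext fun j => ?_)
  rw [affineSimplex_apply]
  refine (FunOnFinite.linearMap_apply_apply ℝ ℝ i.succAbove _ j).trans ?_
  rw [Finset.sum_filter]
  refine Finset.sum_congr rfl fun l _ => ?_
  simp [vertices_apply, Pi.single_apply, eq_comm]

/-- Distance to a fixed point is maximized over a convex hull at some vertex $v_j$. The vector from
the barycenter to $v_j$ is the sum of the $k+1$ differences $v_j-v_i$, $i\ne j$, divided by $k+2$.
-/
lemma dist_bary_le {n k : ℕ} (v : Fin (k + 2) → TopSimplex n) {D : ℝ}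
    (hD : ∀ i j, dist (v i) (v j) ≤ D) {x : TopSimplex n}
    (hx : x.1 ∈ convexHull ℝ (Set.range fun i => (v i).1)) :
    dist (bary n (k + 1) v) x ≤ (k + 1) / (k + 2) * D := by
  obtain ⟨_, ⟨j, rfl⟩, hj⟩ := convexHull_exists_dist_ge hx (bary n (k + 1) v).1
  rw [dist_comm]
  refine le_trans hj ?_
  have h : (v j).1 - (bary n (k + 1) v).1 =
      ∑ i : Fin (k + 1), (k + 2 : ℝ)⁻¹ • ((v j).1 - (v (j.succAbove i)).1) := by
    have h1 : (bary n (k + 1) v).1 = ∑ i : Fin (k + 2), (k + 2 : ℝ)⁻¹ • (v i).1 := by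
      rw [bary, affineSimplex_coe]
      refine Finset.sum_congr rfl fun i _ => ?_
      congr 1
      refine (stdSimplex.barycenter_apply i).trans ?_
      simp
      ring
    rw [h1, Fin.sum_univ_succAbove _ j, ← Finset.smul_sum, ← Finset.smul_sum,
      Finset.sum_sub_distrib]
    simp only [Finset.sum_const, Finset.card_univ, Fintype.card_fin, smul_sub]
    have h2 : (v j).1 = (k + 2 : ℝ)⁻¹ • (v j).1 + (k + 2 : ℝ)⁻¹ • ((k + 1) • (v j).1) := by
      rw [← Nat.cast_smul_eq_nsmul ℝ, smul_smul, ← add_smul]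
      have : (k + 2 : ℝ) ≠ 0 := by positivity
      have h3 : (k + 2 : ℝ)⁻¹ + (k + 2 : ℝ)⁻¹ * ((k + 1 : ℕ) : ℝ) = 1 := by
        push_cast
        field_simp
        ring
      rw [h3, one_smul]
    nth_rewrite 1 [h2]
    abel
  rw [dist_eq_norm, h]
  refine (norm_sum_le _ _).trans ?_
  have h4 : ∀ i ∈ Finset.univ, ‖(k + 2 : ℝ)⁻¹ • ((v j).1 - (v (j.succAbove i)).1)‖ ≤
      (k + 2 : ℝ)⁻¹ * D := by
    intro i _
    rw [norm_smul, Real.norm_of_nonneg (by positivity)]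
    refine mul_le_mul_of_nonneg_left ?_ (by positivity)
    rw [← dist_eq_norm]
    exact hD _ _
  refine (Finset.sum_le_card_nsmul _ _ _ h4).trans (le_of_eq ?_)
  simp
  ring

lemma affineSimplex_mem_convexHull {n k : ℕ} (v : Fin (k + 1) → TopSimplex n) (s : TopSimplex k) :
    (affineSimplex v s).1 ∈ convexHull ℝ (Set.range fun i => (v i).1) :=
  (convex_convexHull ℝ _).sum_mem (fun i _ => s.2.1 i) s.2.2
    fun i _ => subset_convexHull ℝ _ ⟨i, rfl⟩

lemma dist_affineSimplex_le {n k : ℕ} (v : Fin (k + 1) → TopSimplex n) {D : ℝ}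
    (hD : ∀ i j, dist (v i) (v j) ≤ D) (s t : TopSimplex k) :
    dist (affineSimplex v s) (affineSimplex v t) ≤ D := by
  obtain ⟨_, ⟨i, rfl⟩, _, ⟨j, rfl⟩, h⟩ := convexHull_exists_dist_ge2
    (affineSimplex_mem_convexHull v s) (affineSimplex_mem_convexHull v t)
  exact h.trans (hD i j)

end TopSimplex

/-! ### The mesh of iterated subdivisions -/

namespace OrdChain

open TopSimplex

/-- Tuples of points in the convex hull of `v`, at mutual distance at most `D`. -/
def fineTuples {n k : ℕ} (v : Fin (k + 1) → TopSimplex n) (l : ℕ) (D : ℝ) :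
    Set (Fin (l + 1) → TopSimplex n) :=
  {u | (∀ i, (u i).1 ∈ convexHull ℝ (Set.range fun i => (v i).1)) ∧ ∀ i j, dist (u i) (u j) ≤ D}

lemma boundary_single_mem {V : Type*} {k : ℕ} {v : Fin (k + 2) → V} {M : Type*} [AddCommGroup M]
    {N : Submodule ℤ M} (f : OrdChain k V →ₗ[ℤ] M)
    (h : ∀ i : Fin (k + 2), f (Finsupp.single (v ∘ i.succAbove) 1) ∈ N) :
    f (boundary k V (Finsupp.single v 1)) ∈ N := by
  rw [boundary_single, map_sum]
  refine N.sum_mem fun i _ => ?_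
  rw [map_smul]
  exact N.smul_mem _ (h i)

lemma linearMap_mem_of_supported {α : Type*} {M : Type*} [AddCommGroup M] {N : Submodule ℤ M}
    {P : Set α} (f : (α →₀ ℤ) →ₗ[ℤ] M) (h : ∀ a ∈ P, f (Finsupp.single a 1) ∈ N) {c : α →₀ ℤ}
    (hc : c ∈ Finsupp.supported ℤ ℤ P) : f c ∈ N := by
  rw [Finsupp.supported_eq_span_single] at hc
  have : Submodule.span ℤ ((fun i => Finsupp.single i (1 : ℤ)) '' P) ≤ N.comap f := by
    rw [Submodule.span_le]
    rintro _ ⟨a, ha, rfl⟩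
    exact h a ha
  exact this hc

lemma single_mem_supported {α : Type*} {P : Set α} {a : α} (h : a ∈ P) :
    Finsupp.single a (1 : ℤ) ∈ Finsupp.supported ℤ ℤ P :=
  Finsupp.single_mem_supported ℤ 1 h

/-- New edges either join the barycenter to a point of the hull, where `dist_bary_le` applies, or
lie in a subdivided face, where the inductive factor is smaller. The hull condition is carried along
for the first kind. -/
lemma subdiv_single_mem {n : ℕ} : ∀ (k : ℕ) (v : Fin (k + 1) → TopSimplex n) (D : ℝ)
    (_ : ∀ i j, dist (v i) (v j) ≤ D),
    subdiv (bary n) k (Finsupp.single v 1) ∈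
      Finsupp.supported ℤ ℤ (fineTuples v k (k / (k + 1) * D)) := by
  intro k
  induction k with
  | zero =>
    intro v D hD
    rw [subdiv_zero_apply]
    refine single_mem_supported ⟨fun i => subset_convexHull ℝ _ ⟨i, rfl⟩, fun i j => ?_⟩
    rw [Fin.fin_one_eq_zero i, Fin.fin_one_eq_zero j]
    simp
  | succ k ih =>
    intro v D hD
    have hD0 : 0 ≤ D := dist_nonneg.trans (hD 0 0)
    rw [subdiv_single_succ]
    refine boundary_single_mem (cone k (bary n (k + 1) v) ∘ₗ subdiv (bary n) k) fun i => ?_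
    rw [LinearMap.comp_apply]
    refine linearMap_mem_of_supported _ ?_ (ih (v ∘ i.succAbove) D fun a b => hD _ _)
    intro u hu
    rw [cone_single]
    have hu1 : ∀ j, (u j).1 ∈ convexHull ℝ (Set.range fun i => (v i).1) := fun j => by
      refine convexHull_mono ?_ (hu.1 j)
      rintro _ ⟨a, rfl⟩
      exact ⟨_, rfl⟩
    have hb : ∀ j, dist (bary n (k + 1) v) (u j) ≤ ((k + 1 : ℕ) / ((k + 1 : ℕ) + 1) : ℝ) * D :=
      fun j => by
        have := dist_bary_le v hD (hu1 j)
        push_cast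
        rwa [add_assoc (k : ℝ), one_add_one_eq_two]
    refine single_mem_supported ⟨fun j => ?_, fun a b => ?_⟩
    · cases j using Fin.cases with
      | zero => exact affineSimplex_mem_convexHull v _
      | succ j => exact hu1 j
    · cases a using Fin.cases with
      | zero =>
        cases b using Fin.cases with
        | zero => simp only [dist_self]; positivity
        | succ b => exact hb b
      | succ a =>
        cases b using Fin.cases with
        | zero => rw [dist_comm]; exact hb a
        | succ b =>
          refine (hu.2 a b).trans (mul_le_mul_of_nonneg_right ?_ hD0)
          -- The factor $k/(k+1)$ increases with $k$.
          rw [div_le_div_iff₀ (by positivity) (by positivity)]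
          push_cast
          nlinarith

lemma subdiv_iterate_single_mem {n k : ℕ} (v : Fin (k + 1) → TopSimplex n) (D : ℝ)
    (hD : ∀ i j, dist (v i) (v j) ≤ D) (m : ℕ) :
    (subdiv (bary n) k)^[m] (Finsupp.single v 1) ∈
      Finsupp.supported ℤ ℤ {u | ∀ i j, dist (u i) (u j) ≤ (k / (k + 1) : ℝ) ^ m * D} := by
  induction m with
  | zero =>
    refine single_mem_supported ?_
    simpa using hD
  | succ m ih =>
    rw [Function.iterate_succ_apply']
    refine linearMap_mem_of_supported _ ?_ ih
    intro u hu
    refine Finsupp.supported_mono ?_ (subdiv_single_mem k u _ hu)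
    intro w hw i j
    rw [pow_succ', mul_assoc]
    exact hw.2 i j

end OrdChain

/-! ### Subdivision of singular chains and chains subordinate to a cover -/

namespace SingularChain

open TopSimplex

variable {X Y : Type} [TopologicalSpace X] [TopologicalSpace Y]

lemma hom_ext {k : ℕ} {M : Type*} [AddCommGroup M] {f g : SingularChain k X →ₗ[ℤ] M}
    (h : ∀ v, f (Finsupp.single v 1) = g (Finsupp.single v 1)) : f = g :=
  Finsupp.lhom_ext' fun v => LinearMap.ext_ring (h v)

@[simp]
lemma map_single {k : ℕ} (f : C(X, Y)) (σ : C(TopSimplex k, X)) :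
    map k f (Finsupp.single σ 1) = Finsupp.single (f.comp σ) 1 := by
  simp [map, Finsupp.mapDomain_single]

lemma boundary_single {k : ℕ} (σ : C(TopSimplex (k + 1), X)) :
    boundary k X (Finsupp.single σ 1) =
      ∑ i : Fin (k + 2), (-1 : ℤ) ^ (i : ℕ) • Finsupp.single (σ.comp (faceMap i)) 1 := by
  simp [boundary, Finsupp.mapDomain_single]

lemma boundary_map {k : ℕ} (f : C(X, Y)) (c : SingularChain (k + 1) X) :
    boundary k Y (map (k + 1) f c) = map k f (boundary k X c) := by
  suffices h : boundary k Y ∘ₗ map (k + 1) f = map k f ∘ₗ boundary k X from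
    LinearMap.congr_fun h c
  refine hom_ext fun v => ?_
  simp only [LinearMap.comp_apply, map_single, boundary_single, map_sum, map_smul,
    ContinuousMap.comp_assoc]

lemma map_map {k : ℕ} {Z : Type} [TopologicalSpace Z] (f : C(X, Y)) (g : C(Y, Z))
    (c : SingularChain k X) : map k g (map k f c) = map k (g.comp f) c := by
  suffices h : map k g ∘ₗ map k f = map k (g.comp f) from LinearMap.congr_fun h c
  refine hom_ext fun v => ?_
  simp only [LinearMap.comp_apply, map_single, ContinuousMap.comp_assoc]

/-- The singular chain of a chain of affine simplices. -/
noncomputable def realize (k n : ℕ) :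
    OrdChain k (TopSimplex n) →ₗ[ℤ] SingularChain k (TopSimplex n) :=
  Finsupp.lmapDomain ℤ ℤ affineSimplex

@[simp]
lemma realize_single {k n : ℕ} (v : Fin (k + 1) → TopSimplex n) :
    realize k n (Finsupp.single v 1) = Finsupp.single (affineSimplex v) 1 := by
  simp [realize, Finsupp.mapDomain_single]

lemma affineSimplex_comp_faceMap {k n : ℕ} (v : Fin (k + 2) → TopSimplex n) (i : Fin (k + 2)) :
    (affineSimplex v).comp (faceMap i) = affineSimplex (v ∘ i.succAbove) := by
  rw [faceMap_eq, affineSimplex_comp, ← Function.comp_assoc, affineSimplex_comp_vertices]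

lemma boundary_realize {k n : ℕ} (c : OrdChain (k + 1) (TopSimplex n)) :
    boundary k _ (realize (k + 1) n c) = realize k n (OrdChain.boundary k _ c) := by
  suffices h : boundary k _ ∘ₗ realize (k + 1) n = realize k n ∘ₗ OrdChain.boundary k _ from
    LinearMap.congr_fun h c
  refine OrdChain.hom_ext fun v => ?_
  simp only [LinearMap.comp_apply, realize_single, boundary_single, OrdChain.boundary_single,
    map_sum, map_smul, affineSimplex_comp_faceMap]

lemma realize_map {k n m : ℕ} (v : Fin (n + 1) → TopSimplex m) (c : OrdChain k (TopSimplex n)) :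
    realize k m (OrdChain.map k (affineSimplex v) c) = map k (affineSimplex v) (realize k n c) := by
  suffices h : realize k m ∘ₗ OrdChain.map k (affineSimplex v) =
      map k (affineSimplex v) ∘ₗ realize k n from LinearMap.congr_fun h c
  refine OrdChain.hom_ext fun u => ?_
  simp only [LinearMap.comp_apply, realize_single, OrdChain.map_single, map_single,
    affineSimplex_comp]

lemma affineSimplex_bary {n m : ℕ} (v : Fin (n + 1) → TopSimplex m) (k : ℕ)
    (u : Fin (k + 1) → TopSimplex n) :
    affineSimplex v (bary n k u) = bary m k (affineSimplex v ∘ u) :=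
  ContinuousMap.congr_fun (affineSimplex_comp v u) _

/-- Barycentric subdivision of singular chains. -/
noncomputable def subdiv (n : ℕ) (X : Type) [TopologicalSpace X] :
    SingularChain n X →ₗ[ℤ] SingularChain n X :=
  Finsupp.linearCombination ℤ fun σ =>
    map n σ (realize n n (OrdChain.subdiv (bary n) n (Finsupp.single (vertices n) 1)))

/-- The chain homotopy between the identity and barycentric subdivision. -/
noncomputable def subdivHomotopy (n : ℕ) (X : Type) [TopologicalSpace X] :
    SingularChain n X →ₗ[ℤ] SingularChain (n + 1) X :=
  Finsupp.linearCombination ℤ fun σ =>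
    map (n + 1) σ (realize (n + 1) n
      (OrdChain.subdivHomotopy (bary n) n (Finsupp.single (vertices n) 1)))

lemma subdiv_single {n : ℕ} (σ : C(TopSimplex n, X)) :
    subdiv n X (Finsupp.single σ 1) =
      map n σ (realize n n (OrdChain.subdiv (bary n) n (Finsupp.single (vertices n) 1))) := by
  simp [subdiv]

lemma subdivHomotopy_single {n : ℕ} (σ : C(TopSimplex n, X)) :
    subdivHomotopy n X (Finsupp.single σ 1) = map (n + 1) σ (realize (n + 1) n
      (OrdChain.subdivHomotopy (bary n) n (Finsupp.single (vertices n) 1))) := by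
  simp [subdivHomotopy]

lemma subdiv_map {n : ℕ} (f : C(X, Y)) (c : SingularChain n X) :
    subdiv n Y (map n f c) = map n f (subdiv n X c) := by
  suffices h : subdiv n Y ∘ₗ map n f = map n f ∘ₗ subdiv n X from LinearMap.congr_fun h c
  refine hom_ext fun σ => ?_
  simp only [LinearMap.comp_apply, map_single, subdiv_single, map_map]

lemma subdivHomotopy_map {n : ℕ} (f : C(X, Y)) (c : SingularChain n X) :
    subdivHomotopy n Y (map n f c) = map (n + 1) f (subdivHomotopy n X c) := by
  suffices h : subdivHomotopy n Y ∘ₗ map n f = map (n + 1) f ∘ₗ subdivHomotopy n X from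
    LinearMap.congr_fun h c
  refine hom_ext fun σ => ?_
  simp only [LinearMap.comp_apply, map_single, subdivHomotopy_single, map_map]

lemma subdiv_realize {k n : ℕ} (c : OrdChain k (TopSimplex n)) :
    subdiv k _ (realize k n c) = realize k n (OrdChain.subdiv (bary n) k c) := by
  suffices h : subdiv k _ ∘ₗ realize k n = realize k n ∘ₗ OrdChain.subdiv (bary n) k from
    LinearMap.congr_fun h c
  refine OrdChain.hom_ext fun v => ?_
  rw [LinearMap.comp_apply, LinearMap.comp_apply, realize_single, subdiv_single, ← realize_map,
    OrdChain.map_subdiv (affineSimplex_bary v), OrdChain.map_single, affineSimplex_comp_vertices]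

lemma subdivHomotopy_realize {k n : ℕ} (c : OrdChain k (TopSimplex n)) :
    subdivHomotopy k _ (realize k n c) =
      realize (k + 1) n (OrdChain.subdivHomotopy (bary n) k c) := by
  suffices h : subdivHomotopy k _ ∘ₗ realize k n =
      realize (k + 1) n ∘ₗ OrdChain.subdivHomotopy (bary n) k from LinearMap.congr_fun h c
  refine OrdChain.hom_ext fun v => ?_
  rw [LinearMap.comp_apply, LinearMap.comp_apply, realize_single, subdivHomotopy_single,
    ← realize_map, OrdChain.map_subdivHomotopy (affineSimplex_bary v), OrdChain.map_single,
    affineSimplex_comp_vertices]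

/-- Every singular simplex is the image of the identity simplex. By naturality, identities between
chain operators need only be checked on affine chains. -/
lemma single_eq_map_realize {n : ℕ} (σ : C(TopSimplex n, X)) :
    Finsupp.single σ (1 : ℤ) = map n σ (realize n n (Finsupp.single (vertices n) 1)) := by
  rw [realize_single, map_single, affineSimplex_vertices, ContinuousMap.comp_id]

lemma boundary_subdiv {k : ℕ} (c : SingularChain (k + 1) X) :
    boundary k X (subdiv (k + 1) X c) = subdiv k X (boundary k X c) := by
  suffices h : boundary k X ∘ₗ subdiv (k + 1) X = subdiv k X ∘ₗ boundary k X from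
    LinearMap.congr_fun h c
  refine hom_ext fun σ => ?_
  rw [single_eq_map_realize, LinearMap.comp_apply, LinearMap.comp_apply, subdiv_map, boundary_map,
    boundary_map, subdiv_map, subdiv_realize, boundary_realize, boundary_realize, subdiv_realize,
    OrdChain.boundary_subdiv]

lemma boundary_subdivHomotopy {k : ℕ} (c : SingularChain (k + 1) X) :
    boundary (k + 1) X (subdivHomotopy (k + 1) X c) =
      c - subdiv (k + 1) X c - subdivHomotopy k X (boundary k X c) := by
  suffices h : boundary (k + 1) X ∘ₗ subdivHomotopy (k + 1) X =
      LinearMap.id - subdiv (k + 1) X - subdivHomotopy k X ∘ₗ boundary k X from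
    LinearMap.congr_fun h c
  refine hom_ext fun σ => ?_
  rw [single_eq_map_realize, LinearMap.comp_apply, LinearMap.sub_apply, LinearMap.sub_apply,
    LinearMap.comp_apply, subdiv_map, subdivHomotopy_map, boundary_map,
    boundary_map, subdivHomotopy_map, subdiv_realize, subdivHomotopy_realize, boundary_realize,
    boundary_realize, subdivHomotopy_realize, OrdChain.boundary_subdivHomotopy, map_sub, map_sub,
    map_sub, map_sub, LinearMap.id_apply]

/-- The chains all of whose simplices lie in `U` or in `V`. -/
def small (n : ℕ) (U V : Set X) : Submodule ℤ (SingularChain n X) :=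
  Finsupp.supported ℤ ℤ {σ | Set.range σ ⊆ U ∨ Set.range σ ⊆ V}

lemma map_mem_small {n k : ℕ} {U V : Set X} {σ : C(TopSimplex k, X)}
    (h : Set.range σ ⊆ U ∨ Set.range σ ⊆ V) (c : SingularChain n (TopSimplex k)) :
    map n σ c ∈ small n U V := by
  refine OrdChain.linearMap_mem_of_supported (P := Set.univ) _ ?_ (by simp)
  intro τ _
  rw [map_single]
  refine OrdChain.single_mem_supported ?_
  exact h.imp (Set.range_comp_subset_range τ σ).trans (Set.range_comp_subset_range τ σ).trans

lemma subdiv_mem_small {n : ℕ} {U V : Set X} {c : SingularChain n X} (hc : c ∈ small n U V) :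
    subdiv n X c ∈ small n U V := by
  refine OrdChain.linearMap_mem_of_supported _ (fun σ hσ => ?_) hc
  rw [subdiv_single]
  exact map_mem_small hσ _

lemma subdivHomotopy_mem_small {n : ℕ} {U V : Set X} {c : SingularChain n X}
    (hc : c ∈ small n U V) : subdivHomotopy n X c ∈ small (n + 1) U V := by
  refine OrdChain.linearMap_mem_of_supported _ (fun σ hσ => ?_) hc
  rw [subdivHomotopy_single]
  exact map_mem_small hσ _

lemma iterate_subdiv_mem_small {n : ℕ} {U V : Set X} {c : SingularChain n X}
    (hc : c ∈ small n U V) (m : ℕ) : (subdiv n X)^[m] c ∈ small n U V := by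
  induction m with
  | zero => exact hc
  | succ m ih =>
    rw [Function.iterate_succ_apply']
    exact subdiv_mem_small ih

/-- Pull the cover back to the simplex and take a Lebesgue number; iterated subdivision makes the
mesh smaller than it. -/
lemma exists_iterate_subdiv_single_mem_small {n : ℕ} {U V : Set X} (hU : IsOpen U)
    (hV : IsOpen V) (hUV : U ∪ V = Set.univ) (σ : C(TopSimplex n, X)) :
    ∃ m, (subdiv n X)^[m] (Finsupp.single σ 1) ∈ small n U V := by
  obtain ⟨δ, hδ, hδ'⟩ := lebesgue_number_lemma_of_metric (s := (Set.univ : Set (TopSimplex n)))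
    (c := fun b : Bool => σ ⁻¹' (if b then U else V)) isCompact_univ
    (fun b => by
      cases b
      · exact hV.preimage σ.continuous
      · exact hU.preimage σ.continuous)
    (fun x _ => by
      have : σ x ∈ U ∪ V := hUV ▸ Set.mem_univ _
      rw [Set.mem_iUnion]
      rcases this with h | h
      · exact ⟨true, h⟩
      · exact ⟨false, h⟩)
  obtain ⟨m, hm⟩ : ∃ m : ℕ, (n / (n + 1) : ℝ) ^ m * 1 < δ := by
    have : (n / (n + 1) : ℝ) < 1 := by
      rw [div_lt_one (by positivity)]
      exact lt_add_one _
    simpa using exists_pow_lt_of_lt_one hδ this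
  refine ⟨m, ?_⟩
  have h1 : (subdiv n X)^[m] (Finsupp.single σ 1) = map n σ (realize n n
      ((OrdChain.subdiv (bary n) n)^[m] (Finsupp.single (vertices n) 1))) := by
    clear hm
    induction m with
    | zero => exact single_eq_map_realize σ
    | succ m ih =>
      rw [Function.iterate_succ_apply', Function.iterate_succ_apply', ih, subdiv_map,
        subdiv_realize]
  rw [h1]
  refine OrdChain.linearMap_mem_of_supported (map n σ ∘ₗ realize n n) ?_
    (OrdChain.subdiv_iterate_single_mem (vertices n) 1 ?_ m)
  · intro u hu
    rw [LinearMap.comp_apply, realize_single, map_single]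
    refine OrdChain.single_mem_supported ?_
    obtain ⟨b, hb⟩ := hδ' (affineSimplex u (vertices n 0)) (Set.mem_univ _)
    have hs : Set.range (σ.comp (affineSimplex u)) ⊆ if b then U else V := by
      rintro _ ⟨t, rfl⟩
      exact hb ((dist_affineSimplex_le u hu _ _).trans_lt hm)
    cases b
    · exact Or.inr hs
    · exact Or.inl hs
  · intro i j
    refine (Metric.dist_le_diam_of_mem (bounded_stdSimplex _) (vertices n i).2
      (vertices n j).2).trans diam_stdSimplex_le

lemma exists_iterate_subdiv_mem_small {n : ℕ} {U V : Set X} (hU : IsOpen U)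
    (hV : IsOpen V) (hUV : U ∪ V = Set.univ) (c : SingularChain n X) :
    ∃ m, (subdiv n X)^[m] c ∈ small n U V := by
  induction c using Finsupp.induction_linear with
  | zero => exact ⟨0, Submodule.zero_mem _⟩
  | add a b ha hb =>
    obtain ⟨m, hm⟩ := ha
    obtain ⟨l, hl⟩ := hb
    refine ⟨m + l, ?_⟩
    -- Further subdivision keeps small chains small, so the sum of the two exponents serves both
    -- summands.
    rw [← Module.End.pow_apply, map_add, Module.End.pow_apply, Module.End.pow_apply]
    refine Submodule.add_mem _ ?_ ?_
    · rw [add_comm m l, Function.iterate_add_apply]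
      exact iterate_subdiv_mem_small hm l
    · rw [Function.iterate_add_apply]
      exact iterate_subdiv_mem_small hl m
  | single σ a =>
    obtain ⟨m, hm⟩ := exists_iterate_subdiv_single_mem_small hU hV hUV σ
    refine ⟨m, ?_⟩
    rw [← mul_one a, ← smul_eq_mul, ← Finsupp.smul_single, ← Module.End.pow_apply, map_smul,
      Module.End.pow_apply]
    exact Submodule.smul_mem _ _ hm

/-- With $S$ the subdivision and $T$ its homotopy, $w=\sum_{i<m}TS^ic$ changes $c$ into $S^mc$ up to
the terms $TS^i\partial c$. These are small because $\partial c$ is and both operators preserve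
smallness. -/
lemma exists_sub_boundary_mem_small {n : ℕ} {U V : Set X} (hU : IsOpen U)
    (hV : IsOpen V) (hUV : U ∪ V = Set.univ) (c : SingularChain (n + 1) X)
    (hc : boundary n X c ∈ small n U V) :
    ∃ w, c - boundary (n + 1) X w ∈ small (n + 1) U V := by
  obtain ⟨m, hm⟩ := exists_iterate_subdiv_mem_small hU hV hUV c
  suffices h : ∀ m, ∃ w, c - boundary (n + 1) X w - (subdiv (n + 1) X)^[m] c ∈
      small (n + 1) U V by
    obtain ⟨w, hw⟩ := h m
    exact ⟨w, by simpa using Submodule.add_mem _ hw hm⟩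
  intro m
  induction m with
  | zero => exact ⟨0, by simp⟩
  | succ m ih =>
    obtain ⟨w, hw⟩ := ih
    refine ⟨w + subdivHomotopy (n + 1) X ((subdiv (n + 1) X)^[m] c), ?_⟩
    have h1 : boundary n X ((subdiv (n + 1) X)^[m] c) = (subdiv n X)^[m] (boundary n X c) := by
      clear hw hm
      induction m with
      | zero => rfl
      | succ m ih =>
        rw [Function.iterate_succ_apply', Function.iterate_succ_apply', boundary_subdiv, ih]
    have h2 := boundary_subdivHomotopy ((subdiv (n + 1) X)^[m] c)
    have h3 := subdivHomotopy_mem_small (iterate_subdiv_mem_small hc m)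
    rw [h1] at h2
    rw [map_add, h2, Function.iterate_succ_apply']
    convert Submodule.add_mem _ hw h3 using 1
    abel

lemma mem_small_zero {U V : Set X} (hUV : U ∪ V = Set.univ) (c : SingularChain 0 X) :
    c ∈ small 0 U V := by
  refine OrdChain.linearMap_mem_of_supported LinearMap.id (P := Set.univ) ?_ (by simp)
  intro σ _
  refine OrdChain.single_mem_supported ?_
  have : σ (vertices 0 0) ∈ U ∪ V := hUV ▸ Set.mem_univ _
  refine this.imp ?_ ?_ <;>
  · rintro h _ ⟨t, rfl⟩
    rwa [Subsingleton.elim t (vertices 0 0)]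

end SingularChain

/-! ### Small chains as sums, and a criterion for quasi-isomorphisms -/

section

namespace SingularChain

variable {X Y : Type} [TopologicalSpace X] [TopologicalSpace Y]

lemma map_injective {n : ℕ} {f : C(X, Y)} (hf : Function.Injective f) :
    Function.Injective (map n f) :=
  Finsupp.mapDomain_injective fun σ τ h => by
    ext t
    exact hf (ContinuousMap.congr_fun h t)

lemma mem_range_map_incl {n : ℕ} {U : Set X} {c : SingularChain n X}
    (hc : c ∈ Finsupp.supported ℤ ℤ {σ : C(TopSimplex n, X) | Set.range σ ⊆ U}) :
    c ∈ LinearMap.range (map n (incl U)) := by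
  refine OrdChain.linearMap_mem_of_supported LinearMap.id (fun σ hσ => ?_) hc
  refine ⟨Finsupp.single ⟨fun t => ⟨σ t, hσ ⟨t, rfl⟩⟩, by fun_prop⟩ 1, ?_⟩
  rw [map_single]
  rfl

lemma map_incl_mem {n : ℕ} {U : Set X} (c : SingularChain n U) :
    map n (incl U) c ∈ Finsupp.supported ℤ ℤ {σ : C(TopSimplex n, X) | Set.range σ ⊆ U} := by
  refine OrdChain.linearMap_mem_of_supported (P := Set.univ) _ ?_ (by simp)
  intro τ _
  rw [map_single]
  refine OrdChain.single_mem_supported ?_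
  rintro _ ⟨t, rfl⟩
  exact (τ t).2

lemma mem_small_iff {n : ℕ} {U V : Set X} {c : SingularChain n X} :
    c ∈ small n U V ↔ ∃ a b, c = map n (incl U) a - map n (incl V) b := by
  rw [small, Set.ofPred_or, Finsupp.supported_union, Submodule.mem_sup]
  constructor
  · rintro ⟨a, ha, b, hb, rfl⟩
    obtain ⟨a', rfl⟩ := mem_range_map_incl ha
    obtain ⟨b', rfl⟩ := mem_range_map_incl hb
    exact ⟨a', -b', by simp⟩
  · rintro ⟨a, b, rfl⟩
    exact ⟨_, map_incl_mem a, _, Submodule.neg_mem _ (map_incl_mem b), (sub_eq_add_neg _ _).symm⟩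

/-- The inclusion of a subspace into a larger subspace. -/
def _root_.inclOfLE {U V : Set X} (h : U ⊆ V) : C(U, V) :=
  ⟨Set.inclusion h, continuous_inclusion h⟩

/-- A common chain is supported on simplices lying in both sets, hence in the intersection. This is
exactness in the middle of Mayer-Vietoris at chain level. -/
lemma exists_of_map_incl_eq {n : ℕ} {U V : Set X} {a : SingularChain n U} {b : SingularChain n V}
    (h : map n (incl U) a = map n (incl V) b) :
    ∃ c : SingularChain n (U ∩ V : Set X), map n (inclOfLE Set.inter_subset_left) c = a ∧
      map n (inclOfLE Set.inter_subset_right) c = b := by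
  have hc : map n (incl U) a ∈
      Finsupp.supported ℤ ℤ {σ : C(TopSimplex n, X) | Set.range σ ⊆ U ∩ V} := by
    have : {σ : C(TopSimplex n, X) | Set.range σ ⊆ U ∩ V} =
        {σ : C(TopSimplex n, X) | Set.range σ ⊆ U} ∩ {σ | Set.range σ ⊆ V} := by
      ext σ
      exact Set.subset_inter_iff
    rw [this, Finsupp.supported_inter]
    exact ⟨map_incl_mem a, h ▸ map_incl_mem b⟩
  obtain ⟨c, hc⟩ := mem_range_map_incl hc
  refine ⟨c, map_injective (f := incl U) Subtype.val_injective ?_,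
    map_injective (f := incl V) Subtype.val_injective ?_⟩
  · rw [map_map, ← hc]
    rfl
  · rw [map_map, ← h, ← hc]
    rfl

end SingularChain

open CategoryTheory Limits

lemma quasiIso_of_acyclic_cokernel
    {S : ShortComplex (HomologicalComplex (ModuleCat.{0} ℤ) (ComplexShape.down ℕ))} (hS : S.ShortExact)
    (h : S.X₃.Acyclic) : QuasiIso S.f := by
  rw [quasiIso_iff]
  intro i
  rw [quasiIsoAt_iff_isIso_homologyMap]
  have h1 : Mono (HomologicalComplex.homologyMap S.f i) :=
    (hS.homology_exact₁ (i + 1) i rfl).mono_g ((h (i + 1)).isZero_homology.eq_of_src _ _)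
  have h2 : Epi (HomologicalComplex.homologyMap S.f i) :=
    (hS.homology_exact₂ i).epi_f ((h i).isZero_homology.eq_of_tgt _ _)
  exact isIso_of_mono_of_epi _

/-- The hypotheses say that the cokernel vanishes in degree 0 and that each of its cycles in
positive degree bounds, so the cokernel is acyclic. -/
lemma quasiIso_of_mono {K L : ChainComplex (ModuleCat.{0} ℤ) ℕ} (q : K ⟶ L) [Mono q]
    (h0 : ∀ z, z ∈ LinearMap.range (q.f 0).hom)
    (h1 : ∀ n z, (L.d (n + 1) n).hom z ∈ LinearMap.range (q.f n).hom →
      ∃ w, z - (L.d (n + 2) (n + 1)).hom w ∈ LinearMap.range (q.f (n + 1)).hom) :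
    QuasiIso q := by
  let S := ShortComplex.mk q (cokernel.π q) (cokernel.condition q)
  have hS : S.ShortExact :=
    { exact := ShortComplex.exact_cokernel q
      mono_f := inferInstance
      epi_g := inferInstance }
  refine quasiIso_of_acyclic_cokernel hS fun n => ?_
  have hsurj : ∀ n, Function.Surjective ((cokernel.π q).f n).hom := fun n => by
    rw [← ModuleCat.epi_iff_surjective]
    infer_instance
  have hex : ∀ n z, ((cokernel.π q).f n).hom z = 0 → z ∈ LinearMap.range (q.f n).hom := by
    intro n z hz
    have := hS.exact.map (HomologicalComplex.eval _ _ n)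
    rw [ShortComplex.moduleCat_exact_iff] at this
    exact this z hz
  have hz : ∀ n z, z ∈ LinearMap.range (q.f n).hom → ((cokernel.π q).f n).hom z = 0 := by
    rintro n _ ⟨z, rfl⟩
    have := congrArg (fun φ => (φ.f n).hom z) (cokernel.condition q)
    exact this
  cases n with
  | zero =>
    refine HomologicalComplex.ExactAt.of_isZero ?_
    have : Subsingleton ((cokernel q).X 0) := by
      refine ⟨fun a b => ?_⟩
      obtain ⟨a, rfl⟩ := hsurj 0 a
      obtain ⟨b, rfl⟩ := hsurj 0 b
      rw [hz 0 a (h0 a), hz 0 b (h0 b)]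
    exact ModuleCat.isZero_of_subsingleton _
  | succ n =>
    rw [HomologicalComplex.exactAt_iff' _ (n + 2) (n + 1) n (by simp) (by simp),
      ShortComplex.moduleCat_exact_iff]
    intro y hy
    obtain ⟨z, rfl⟩ := hsurj (n + 1) y
    have hc : ∀ i j z, ((cokernel q).d i j).hom (((cokernel.π q).f i).hom z) =
        ((cokernel.π q).f j).hom ((L.d i j).hom z) := fun i j z =>
      (congrArg (fun φ => φ.hom z) ((cokernel.π q).comm i j))
    obtain ⟨w, hw⟩ := h1 n z (hex n _ ((hc _ _ z).symm.trans hy))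
    refine ⟨((cokernel.π q).f (n + 2)).hom w, ?_⟩
    have := hz _ _ hw
    rw [map_sub, sub_eq_zero] at this
    exact (hc _ _ w).trans this.symm

end

/-! ### The Mayer-Vietoris square of singular chain complexes -/

section

open CategoryTheory Limits

/-- The chain map induced by a continuous map. -/
noncomputable abbrev chainMap {X Y : Type} [TopologicalSpace X] [TopologicalSpace Y] (f : C(X, Y)) :
    chainsFunctor.obj (TopCat.of X) ⟶ chainsFunctor.obj (TopCat.of Y) :=
  chainsFunctor.map (TopCat.ofHom f)

section

variable {X Y Z : Type} [TopologicalSpace X] [TopologicalSpace Y] [TopologicalSpace Z]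

lemma chainMap_comp (f : C(X, Y)) (g : C(Y, Z)) :
    chainMap f ≫ chainMap g = chainMap (g.comp f) := by
  rw [← Functor.map_comp]
  rfl

lemma chains_d_apply (n : ℕ) (z : SingularChain (n + 1) X) :
    ((chainsFunctor.obj (TopCat.of X)).d (n + 1) n).hom z = SingularChain.boundary n X z := by
  rw [chainsFunctor_obj_d]
  rfl

lemma mono_chainMap {f : C(X, Y)} (hf : Function.Injective f) : Mono (chainMap f) := by
  have : ∀ n, Mono ((chainMap f).f n) := fun n => by
    rw [ModuleCat.mono_iff_injective]
    exact SingularChain.map_injective hf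
  exact HomologicalComplex.mono_of_mono_f _ this

end

namespace MayerVietoris

variable {X : Type} [TopologicalSpace X] (U V : Set X)

/-- The inclusion of the intersection in the first set. -/
abbrev interLeft : C((U ∩ V : Set X), U) := inclOfLE Set.inter_subset_left

/-- The inclusion of the intersection in the second set. -/
abbrev interRight : C((U ∩ V : Set X), V) := inclOfLE Set.inter_subset_right

/-- The Mayer-Vietoris sequence of chain complexes. -/
noncomputable def complex : ShortComplex (ChainComplex (ModuleCat.{0} ℤ) ℕ) :=
  ShortComplex.mk (X₁ := chainsFunctor.obj (TopCat.of (U ∩ V : Set X)))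
    (X₂ := chainsFunctor.obj (TopCat.of U) ⊞ chainsFunctor.obj (TopCat.of V))
    (X₃ := chainsFunctor.obj (TopCat.of X))
    (biprod.lift (chainMap (interLeft U V)) (chainMap (interRight U V)))
    (biprod.desc (chainMap (incl U)) (-chainMap (incl V)))
    (by
      rw [biprod.lift_desc, Preadditive.comp_neg, chainMap_comp, chainMap_comp]
      exact add_neg_cancel _)

instance : Mono (complex U V).f := by
  have h : Mono (biprod.lift (chainMap (interLeft U V)) (chainMap (interRight U V)) ≫
      biprod.fst) := by
    rw [biprod.lift_fst]
    exact mono_chainMap (Set.inclusion_injective Set.inter_subset_left)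
  exact @mono_of_mono _ _ _ _ _ _ biprod.fst h

lemma biprod_ext {K L : ChainComplex (ModuleCat.{0} ℤ) ℕ} {n : ℕ} {y y' : (K ⊞ L).X n}
    (h1 : ((biprod.fst : K ⊞ L ⟶ K).f n).hom y = ((biprod.fst : K ⊞ L ⟶ K).f n).hom y')
    (h2 : ((biprod.snd : K ⊞ L ⟶ L).f n).hom y = ((biprod.snd : K ⊞ L ⟶ L).f n).hom y') :
    y = y' := by
  have h : ∀ y : (K ⊞ L).X n, y =
      ((biprod.inl : K ⟶ K ⊞ L).f n).hom (((biprod.fst : K ⊞ L ⟶ K).f n).hom y) +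
      ((biprod.inr : L ⟶ K ⊞ L).f n).hom (((biprod.snd : K ⊞ L ⟶ L).f n).hom y) := fun y =>
    (congrArg (fun φ => φ.hom y) (HomologicalComplex.biprod_total_f K L n)).symm
  rw [h y, h1, h2, ← h]

lemma desc_f_apply {K L M : ChainComplex (ModuleCat.{0} ℤ) ℕ} {n : ℕ} (f : K ⟶ M) (g : L ⟶ M)
    (y : (K ⊞ L).X n) : ((biprod.desc f g).f n).hom y =
      (f.f n).hom (((biprod.fst : K ⊞ L ⟶ K).f n).hom y) +
      (g.f n).hom (((biprod.snd : K ⊞ L ⟶ L).f n).hom y) := by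
  have := congrArg (fun φ => (φ.f n).hom y) (biprod.desc_eq (f := f) (g := g))
  exact this

lemma fst_lift_f_apply {K L M : ChainComplex (ModuleCat.{0} ℤ) ℕ} {n : ℕ} (f : M ⟶ K) (g : M ⟶ L)
    (y : M.X n) : ((biprod.fst : K ⊞ L ⟶ K).f n).hom (((biprod.lift f g).f n).hom y) =
      (f.f n).hom y :=
  congrArg (fun φ => (φ.f n).hom y) (biprod.lift_fst f g)

lemma snd_lift_f_apply {K L M : ChainComplex (ModuleCat.{0} ℤ) ℕ} {n : ℕ} (f : M ⟶ K) (g : M ⟶ L)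
    (y : M.X n) : ((biprod.snd : K ⊞ L ⟶ L).f n).hom (((biprod.lift f g).f n).hom y) =
      (g.f n).hom y :=
  congrArg (fun φ => (φ.f n).hom y) (biprod.lift_snd f g)

/-- Exactness is claimed only in the middle. The last map reaches just the small chains, so the
cokernel of the first map will stand in for the chains of `X`. -/
lemma complex_exact : (complex U V).Exact := by
  apply HomologicalComplex.exact_of_degreewise_exact
  intro n
  rw [ShortComplex.moduleCat_exact_iff]
  intro y hy
  have hy' := (desc_f_apply (chainMap (incl U)) (-chainMap (incl V)) y).symm.trans hy
  have h := SingularChain.exists_of_map_incl_eq (eq_of_sub_eq_zero ((sub_eq_add_neg _ _).trans hy'))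
  obtain ⟨c, hc1, hc2⟩ := h
  refine ⟨c, biprod_ext ?_ ?_⟩
  · exact (fst_lift_f_apply _ _ _).trans hc1
  · exact (snd_lift_f_apply _ _ _).trans hc2

/-- The sum of the chain complexes of two subspaces. -/
noncomputable def sumToChains : cokernel (complex U V).f ⟶ (complex U V).X₃ :=
  cokernel.desc _ (complex U V).g (complex U V).zero

instance : Mono (sumToChains U V) := (complex_exact U V).mono_cokernelDesc

lemma mem_range_sumToChains {n : ℕ} {z : SingularChain n X} :
    z ∈ LinearMap.range ((sumToChains U V).f n).hom ↔ z ∈ SingularChain.small n U V := by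
  rw [SingularChain.mem_small_iff]
  have hfac : ∀ y, ((sumToChains U V).f n).hom (((cokernel.π (complex U V).f).f n).hom y) =
      SingularChain.map n (incl U) (((biprod.fst : chainsFunctor.obj (TopCat.of U) ⊞
        chainsFunctor.obj (TopCat.of V) ⟶ _).f n).hom y) - SingularChain.map n (incl V)
        (((biprod.snd : chainsFunctor.obj (TopCat.of U) ⊞
        chainsFunctor.obj (TopCat.of V) ⟶ _).f n).hom y) := fun y =>
    (congrArg (fun φ => (φ.f n).hom y)
      (cokernel.π_desc _ (complex U V).g (complex U V).zero)).trans
        ((desc_f_apply (chainMap (incl U)) (-chainMap (incl V)) y).trans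
          (sub_eq_add_neg _ _).symm)
  constructor
  · rintro ⟨y, rfl⟩
    have hsurj : Function.Surjective ((cokernel.π (complex U V).f).f n).hom := by
      rw [← ModuleCat.epi_iff_surjective]
      infer_instance
    obtain ⟨y, rfl⟩ := hsurj y
    exact ⟨_, _, hfac y⟩
  · rintro ⟨a, b, rfl⟩
    have h1 := fst_lift_f_apply (n := n) (𝟙 (chainsFunctor.obj (TopCat.of U))) (0 : _ ⟶ chainsFunctor.obj (TopCat.of V)) a
    have h2 := snd_lift_f_apply (n := n) (𝟙 (chainsFunctor.obj (TopCat.of U))) (0 : _ ⟶ chainsFunctor.obj (TopCat.of V)) a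
    have h3 := fst_lift_f_apply (n := n) (0 : _ ⟶ chainsFunctor.obj (TopCat.of U)) (𝟙 (chainsFunctor.obj (TopCat.of V))) b
    have h4 := snd_lift_f_apply (n := n) (0 : _ ⟶ chainsFunctor.obj (TopCat.of U)) (𝟙 (chainsFunctor.obj (TopCat.of V))) b
    refine ⟨((cokernel.π (complex U V).f).f n).hom
      (((biprod.lift (𝟙 (chainsFunctor.obj (TopCat.of U)))
        (0 : _ ⟶ chainsFunctor.obj (TopCat.of V))).f n).hom a +
      ((biprod.lift (0 : _ ⟶ chainsFunctor.obj (TopCat.of U))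
        (𝟙 (chainsFunctor.obj (TopCat.of V)))).f n).hom b), ?_⟩
    refine (hfac _).trans ?_
    rw [map_add, map_add, h1, h2, h3, h4]
    congr 2
    · exact add_zero a
    · exact zero_add b

/-- The image consists of the small chains, and subdivision makes every relative cycle homologous to
a small one. Openness of the cover enters here. -/
lemma quasiIso_sumToChains (hU : IsOpen U) (hV : IsOpen V) (hUV : U ∪ V = Set.univ) :
    QuasiIso (sumToChains U V) := by
  refine quasiIso_of_mono _ (fun z => ?_) fun n z hz => ?_
  · exact (mem_range_sumToChains U V).2 (SingularChain.mem_small_zero hUV z)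
  · have hz' := (mem_range_sumToChains U V).1 hz
    obtain ⟨w, hw⟩ := SingularChain.exists_sub_boundary_mem_small hU hV hUV z
      ((chains_d_apply n z) ▸ hz')
    refine ⟨w, (mem_range_sumToChains U V).2 ?_⟩
    rwa [← chains_d_apply] at hw

lemma square_zero : biprod.lift (chainMap (interLeft U V)) (chainMap (interRight U V)) ≫
    biprod.desc (chainMap (incl U)) (-chainMap (incl V)) = 0 :=
  (complex U V).zero

instance : Mono (biprod.lift (chainMap (interLeft U V)) (chainMap (interRight U V))) :=
  inferInstanceAs (Mono (complex U V).f)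

lemma quasiIso_desc (hU : IsOpen U) (hV : IsOpen V) (hUV : U ∪ V = Set.univ) :
    QuasiIso (cokernel.desc _ _ (square_zero U V)) :=
  quasiIso_sumToChains U V hU hV hUV

end MayerVietoris

end

/-! ### The long exact sequence of a square of complexes -/

section

open CategoryTheory Limits

namespace MayerVietoris

section Algebra

variable {K L M N K' L' M' N' : ChainComplex (ModuleCat.{0} ℤ) ℕ} {n : ℕ}

/-- The linear map induced on homology by a chain map. -/
noncomputable def hmap (n : ℕ) (f : K ⟶ L) : K.homology n →ₗ[ℤ] L.homology n :=
  (HomologicalComplex.homologyMap f n).hom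

lemma hmap_hmap (f : K ⟶ L) (g : L ⟶ M) (y : K.homology n) :
    hmap n g (hmap n f y) = hmap n (f ≫ g) y := by
  rw [hmap, hmap, hmap, HomologicalComplex.homologyMap_comp]
  rfl

lemma hmap_id (y : K.homology n) : hmap n (𝟙 K) y = y := by
  rw [hmap, HomologicalComplex.homologyMap_id]
  rfl

lemma hmap_add (f g : K ⟶ L) (y : K.homology n) : hmap n (f + g) y = hmap n f y + hmap n g y := by
  rw [hmap, HomologicalComplex.homologyMap_add]
  rfl

lemma hmap_neg (f : K ⟶ L) (y : K.homology n) : hmap n (-f) y = -hmap n f y := by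
  rw [hmap, HomologicalComplex.homologyMap_neg]
  rfl

lemma hmap_zero (y : K.homology n) : hmap n (0 : K ⟶ L) y = 0 := by
  rw [hmap, HomologicalComplex.homologyMap_zero]
  rfl

lemma hmap_bijective (f : K ⟶ L) (h : QuasiIso f) : Function.Bijective (hmap n f) := by
  have : IsIso (HomologicalComplex.homologyMap f n) :=
    (quasiIsoAt_iff_isIso_homologyMap f n).1 ((quasiIso_iff f).1 h n)
  exact ConcreteCategory.bijective_of_isIso (HomologicalComplex.homologyMap f n)

lemma hmap_biprod_decomp (y : (K ⊞ L).homology n) :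
    y = hmap n biprod.inl (hmap n (biprod.fst : K ⊞ L ⟶ K) y) +
      hmap n biprod.inr (hmap n (biprod.snd : K ⊞ L ⟶ L) y) := by
  rw [hmap_hmap, hmap_hmap, ← hmap_add, biprod.total, hmap_id]

/-- The connecting map of a short exact sequence of chain complexes. -/
noncomputable def connecting {f : K ⟶ L} {g : L ⟶ M} {w : f ≫ g = 0}
    (hS : (ShortComplex.mk f g w).ShortExact) (n : ℕ) :
    M.homology (n + 1) →ₗ[ℤ] K.homology n :=
  (hS.δ (n + 1) n rfl).hom

section

variable {f : K ⟶ L} {g : L ⟶ M} {w : f ≫ g = 0} (hS : (ShortComplex.mk f g w).ShortExact)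

lemma connecting_eq_zero_iff (y : M.homology (n + 1)) :
    connecting hS n y = 0 ↔ ∃ x, hmap (n + 1) g x = y := by
  constructor
  · exact (ShortComplex.moduleCat_exact_iff _).1 (hS.homology_exact₃ (n + 1) n rfl) y
  · rintro ⟨x, rfl⟩
    exact congrArg (fun φ => φ.hom x) (hS.comp_δ (n + 1) n rfl)

lemma exists_connecting_eq_iff (y : K.homology n) :
    (∃ x, connecting hS n x = y) ↔ hmap n f y = 0 := by
  constructor
  · rintro ⟨x, rfl⟩
    exact congrArg (fun φ => φ.hom x) (hS.δ_comp (n + 1) n rfl)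
  · exact (ShortComplex.moduleCat_exact_iff _).1 (hS.homology_exact₁ (n + 1) n rfl) y

include hS in
lemma exists_hmap_of_hmap_eq_zero {y : L.homology n} (hy : hmap n g y = 0) :
    ∃ x, hmap n f x = y :=
  (ShortComplex.moduleCat_exact_iff _).1 (hS.homology_exact₂ n) y hy

lemma hmap_zero_surjective (g : L ⟶ M) [Epi g] : Function.Surjective (hmap 0 g) := by
  have : Epi (HomologicalComplex.homologyMap g 0) :=
    HomologicalComplex.epi_homologyMap_of_epi_of_not_rel g 0 (by simp)
  exact (ModuleCat.epi_iff_surjective _).1 this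

lemma connecting_naturality {f' : K' ⟶ L'} {g' : L' ⟶ M'} {w' : f' ≫ g' = 0}
    (hS' : (ShortComplex.mk f' g' w').ShortExact) (α : K ⟶ K') (β : L ⟶ L') (γ : M ⟶ M')
    (h₁ : α ≫ f' = f ≫ β) (h₂ : β ≫ g' = g ≫ γ) (y : M.homology (n + 1)) :
    hmap n α (connecting hS n y) = connecting hS' n (hmap (n + 1) γ y) :=
  congrArg (fun φ => φ.hom y) (HomologicalComplex.HomologySequence.δ_naturality
    (ShortComplex.homMk (S₁ := ShortComplex.mk f g w) (S₂ := ShortComplex.mk f' g' w')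
      α β γ h₁ h₂) hS hS' (n + 1) n rfl)

end

section Square

variable {i : N ⟶ K} {j : N ⟶ L} {k : K ⟶ M} {l : L ⟶ M}

lemma hmap_desc_neg (x : (K ⊞ L).homology n) :
    hmap n (biprod.desc k (-l)) x =
      hmap n k (hmap n biprod.fst x) - hmap n l (hmap n biprod.snd x) := by
  rw [biprod.desc_eq, hmap_add, Preadditive.comp_neg, hmap_neg, hmap_hmap, hmap_hmap,
    sub_eq_add_neg]

lemma hmap_desc_neg_inl_add_inr (a : K.homology n) (b : L.homology n) :
    hmap n (biprod.desc k (-l)) (hmap n biprod.inl a + hmap n biprod.inr b) =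
      hmap n k a - hmap n l b := by
  rw [map_add, hmap_hmap, hmap_hmap, biprod.inl_desc, biprod.inr_desc, hmap_neg, sub_eq_add_neg]

lemma hmap_lift_eq_iff (c : N.homology n) (a : K.homology n) (b : L.homology n) :
    hmap n (biprod.lift i j) c = hmap n biprod.inl a + hmap n biprod.inr b ↔
      hmap n i c = a ∧ hmap n j c = b := by
  constructor
  · intro h
    have h1 := congrArg (hmap n biprod.fst) h
    have h2 := congrArg (hmap n biprod.snd) h
    rw [map_add, hmap_hmap, hmap_hmap, hmap_hmap, biprod.lift_fst, biprod.inl_fst,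
      biprod.inr_fst, hmap_id, hmap_zero, add_zero] at h1
    rw [map_add, hmap_hmap, hmap_hmap, hmap_hmap, biprod.lift_snd, biprod.inl_snd,
      biprod.inr_snd, hmap_id, hmap_zero, zero_add] at h2
    exact ⟨h1, h2⟩
  · rintro ⟨rfl, rfl⟩
    refine (hmap_biprod_decomp _).trans ?_
    rw [hmap_hmap (biprod.lift i j), hmap_hmap (biprod.lift i j), biprod.lift_fst,
      biprod.lift_snd]

variable (w : biprod.lift i j ≫ biprod.desc k (-l) = 0)

lemma hmap_cokernelDesc (x : (K ⊞ L).homology n) :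
    hmap n (cokernel.desc _ _ w) (hmap n (cokernel.π (biprod.lift i j)) x) =
      hmap n (biprod.desc k (-l)) x := by
  rw [hmap_hmap, cokernel.π_desc]

lemma shortExact_cokernel (f : N ⟶ M) [Mono f] :
    (ShortComplex.mk f (cokernel.π f) (cokernel.condition f)).ShortExact where
  exact := ShortComplex.exact_cokernel _
  mono_f := inferInstance
  epi_g := coequalizer.π_epi

/-- The isomorphism on homology induced by a quasi-isomorphism. -/
noncomputable def hmapEquiv (q : K ⟶ L) (hq : QuasiIso q) (n : ℕ) :
    K.homology n ≃ₗ[ℤ] L.homology n :=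
  LinearEquiv.ofBijective (hmap n q) (hmap_bijective _ hq)

variable [Mono (biprod.lift i j)] (hq : QuasiIso (cokernel.desc _ _ w))

/-- The connecting map of the Mayer-Vietoris sequence of a square of chain complexes. -/
noncomputable def squareδ (n : ℕ) : M.homology (n + 1) →ₗ[ℤ] N.homology n :=
  connecting (shortExact_cokernel (biprod.lift i j)) n ∘ₗ (hmapEquiv _ hq (n + 1)).symm.toLinearMap

lemma squareδ_hmapEquiv (y : (cokernel (biprod.lift i j)).homology (n + 1)) :
    squareδ w hq n (hmap (n + 1) (cokernel.desc _ _ w) y) =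
      connecting (shortExact_cokernel (biprod.lift i j)) n y := by
  rw [squareδ, LinearMap.comp_apply]
  congr 1
  exact (hmapEquiv _ hq (n + 1)).symm_apply_apply y

/-- Exactness at the homology of `M`, carried over from the cokernel through the quasi-isomorphism;
the sign in the square produces the difference. -/
lemma squareδ_eq_zero_iff (z : M.homology (n + 1)) :
    squareδ w hq n z = 0 ↔ ∃ a b, z = hmap (n + 1) k a - hmap (n + 1) l b := by
  obtain ⟨y, rfl⟩ := (hmap_bijective _ hq).2 z
  rw [squareδ_hmapEquiv, connecting_eq_zero_iff]
  constructor
  · rintro ⟨x, rfl⟩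
    exact ⟨_, _, (hmap_cokernelDesc w x).trans (hmap_desc_neg x)⟩
  · rintro ⟨a, b, hab⟩
    rw [← hmap_desc_neg_inl_add_inr, ← hmap_cokernelDesc w] at hab
    exact ⟨_, ((hmap_bijective _ hq).1 hab).symm⟩

lemma exists_squareδ_eq_iff (c : N.homology n) :
    (∃ z, squareδ w hq n z = c) ↔ hmap n i c = 0 ∧ hmap n j c = 0 := by
  have h := hmap_lift_eq_iff (i := i) (j := j) c 0 0
  rw [map_zero, map_zero, add_zero] at h
  rw [← h, ← exists_connecting_eq_iff (shortExact_cokernel (biprod.lift i j))]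
  constructor
  · rintro ⟨z, rfl⟩
    obtain ⟨y, rfl⟩ := (hmap_bijective _ hq).2 z
    exact ⟨y, (squareδ_hmapEquiv w hq y).symm⟩
  · rintro ⟨y, rfl⟩
    exact ⟨_, squareδ_hmapEquiv w hq y⟩

include hq in
lemma exists_square_of_hmap_eq {a : K.homology n} {b : L.homology n}
    (h : hmap n k a = hmap n l b) : ∃ c, hmap n i c = a ∧ hmap n j c = b := by
  have h0 := sub_eq_zero.2 h
  rw [← hmap_desc_neg_inl_add_inr, ← hmap_cokernelDesc w] at h0
  obtain ⟨c, hc⟩ := exists_hmap_of_hmap_eq_zero (shortExact_cokernel (biprod.lift i j))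
    ((hmap_bijective _ hq).1 (h0.trans (map_zero _).symm))
  exact ⟨c, (hmap_lift_eq_iff c a b).1 hc⟩

-- The sequence ends in degree 0, where a surjective chain map is surjective on homology.
omit [Mono (biprod.lift i j)] in
include hq in
lemma exists_eq_sub_of_homology_zero (z : M.homology 0) :
    ∃ a b, z = hmap 0 k a - hmap 0 l b := by
  obtain ⟨y, rfl⟩ := (hmap_bijective _ hq).2 z
  have : Epi (cokernel.π (biprod.lift i j)) := coequalizer.π_epi
  obtain ⟨x, rfl⟩ := hmap_zero_surjective (cokernel.π (biprod.lift i j)) y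
  exact ⟨_, _, (hmap_cokernelDesc w x).trans (hmap_desc_neg x)⟩

lemma squareδ_naturality {i' : N' ⟶ K'} {j' : N' ⟶ L'} {k' : K' ⟶ M'} {l' : L' ⟶ M'}
    (w' : biprod.lift i' j' ≫ biprod.desc k' (-l') = 0) [Mono (biprod.lift i' j')]
    (hq' : QuasiIso (cokernel.desc _ _ w')) (ν : N ⟶ N') (κ : K ⟶ K') (lam : L ⟶ L') (μ : M ⟶ M')
    (h₁ : ν ≫ i' = i ≫ κ) (h₂ : ν ≫ j' = j ≫ lam) (h₃ : κ ≫ k' = k ≫ μ) (h₄ : lam ≫ l' = l ≫ μ)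
    (z : M.homology (n + 1)) :
    hmap n ν (squareδ w hq n z) = squareδ w' hq' n (hmap (n + 1) μ z) := by
  obtain ⟨y, rfl⟩ := (hmap_bijective _ hq).2 z
  have h : biprod.lift i j ≫ biprod.map κ lam = ν ≫ biprod.lift i' j' := by
    apply biprod.hom_ext
    · simp [h₁]
    · simp [h₂]
  have h' : cokernel.desc _ _ w ≫ μ =
      cokernel.map _ _ ν (biprod.map κ lam) h ≫ cokernel.desc _ _ w' := by
    rw [← cancel_epi (cokernel.π (biprod.lift i j))]
    simp only [cokernel.π_desc_assoc, cokernel.map]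
    apply biprod.hom_ext'
    · simp [h₃]
    · simp [h₄]
  rw [hmap_hmap, h', ← hmap_hmap, squareδ_hmapEquiv, squareδ_hmapEquiv]
  exact connecting_naturality _ _ _ (biprod.map κ lam) _ h.symm (cokernel.π_desc _ _ _).symm _

end Square

end Algebra

end MayerVietoris

end

/-! ### Homotopy invariance and Mayer-Vietoris for singular homology -/

section

open CategoryTheory Limits

namespace Homology

section Basic

variable {X Y Z : Type} [TopologicalSpace X] [TopologicalSpace Y] [TopologicalSpace Z] {n : ℕ}

lemma map_id (z : Homology n X) : map n (ContinuousMap.id X) z = z :=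
  congrArg (fun φ => φ.hom z) (((AlgebraicTopology.singularHomologyFunctor
    (ModuleCat.{0} ℤ) n).obj (ModuleCat.of ℤ ℤ)).map_id (TopCat.of X))

lemma map_map (f : C(X, Y)) (g : C(Y, Z)) (z : Homology n X) :
    map n g (map n f z) = map n (g.comp f) z :=
  (congrArg (fun φ => φ.hom z) (((AlgebraicTopology.singularHomologyFunctor
    (ModuleCat.{0} ℤ) n).obj (ModuleCat.of ℤ ℤ)).map_comp (TopCat.ofHom f) (TopCat.ofHom g))).symm

lemma map_eq_of_homotopic {f g : C(X, Y)} (h : f.Homotopic g) (z : Homology n X) :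
    map n f z = map n g z := by
  obtain ⟨H⟩ := h
  have H' : TopCat.Homotopy (TopCat.ofHom f) (TopCat.ofHom g) := H
  exact congrArg (fun φ => φ.hom z)
    (H'.congr_homologyMap_singularChainComplexFunctor (ModuleCat.of ℤ ℤ) n)

/-- Homotopy equivalences induce isomorphisms in homology. -/
noncomputable def equivOfHomotopic (f : C(X, Y)) (g : C(Y, X))
    (hgf : (g.comp f).Homotopic (ContinuousMap.id X))
    (hfg : (f.comp g).Homotopic (ContinuousMap.id Y)) (n : ℕ) :
    Homology n X ≃ₗ[ℤ] Homology n Y :=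
  LinearEquiv.ofLinearMap (map n f) (map n g)
    (LinearMap.ext fun z => by
      rw [LinearMap.comp_apply, map_map, map_eq_of_homotopic hfg, map_id]; rfl)
    (LinearMap.ext fun z => by
      rw [LinearMap.comp_apply, map_map, map_eq_of_homotopic hgf, map_id]; rfl)

lemma map_bijective_of_homotopic (f : C(X, Y)) (g : C(Y, X))
    (hgf : (g.comp f).Homotopic (ContinuousMap.id X))
    (hfg : (f.comp g).Homotopic (ContinuousMap.id Y)) (n : ℕ) :
    Function.Bijective (map n f) :=
  (equivOfHomotopic f g hgf hfg n).bijective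

end Basic

section MayerVietoris

open MayerVietoris

/-- Singular homology is the homology of the complex of singular chains. -/
noncomputable def chainEquiv (n : ℕ) (X : Type) [TopologicalSpace X] :
    Homology n X ≃ₗ[ℤ] (chainsFunctor.obj (TopCat.of X)).homology n :=
  (homologyIso n X).toLinearEquiv

lemma chainEquiv_map {X Y : Type} [TopologicalSpace X] [TopologicalSpace Y] (n : ℕ)
    (f : C(X, Y)) (z : Homology n X) :
    chainEquiv n Y (map n f z) = hmap n (chainMap f) (chainEquiv n X z) :=
  homologyIso_naturality n f z

variable {X : Type} [TopologicalSpace X] {U V : Set X} (hU : IsOpen U) (hV : IsOpen V)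
  (hUV : U ∪ V = Set.univ) {n : ℕ}

/-- The connecting map of the Mayer-Vietoris sequence. -/
noncomputable def mvδ (n : ℕ) : Homology (n + 1) X →ₗ[ℤ] Homology n (U ∩ V : Set X) :=
  (chainEquiv n _).symm.toLinearMap ∘ₗ
    squareδ (square_zero U V) (quasiIso_desc U V hU hV hUV) n ∘ₗ
      (chainEquiv (n + 1) X).toLinearMap

lemma chainEquiv_mvδ (z : Homology (n + 1) X) :
    chainEquiv n _ (mvδ hU hV hUV n z) =
      squareδ (square_zero U V) (quasiIso_desc U V hU hV hUV) n
        (chainEquiv (n + 1) X z) :=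
  (chainEquiv n _).apply_symm_apply _

lemma mvδ_eq_zero_iff (z : Homology (n + 1) X) :
    mvδ hU hV hUV n z = 0 ↔
      ∃ a b, z = map (n + 1) (incl U) a - map (n + 1) (incl V) b := by
  rw [← (chainEquiv n _).map_eq_zero_iff, chainEquiv_mvδ, squareδ_eq_zero_iff]
  constructor
  · rintro ⟨a, b, h⟩
    refine ⟨(chainEquiv _ U).symm a, (chainEquiv _ V).symm b, (chainEquiv _ X).injective ?_⟩
    rw [h, map_sub, chainEquiv_map, chainEquiv_map, LinearEquiv.apply_symm_apply,
      LinearEquiv.apply_symm_apply]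
  · rintro ⟨a, b, rfl⟩
    exact ⟨_, _, by rw [map_sub, chainEquiv_map, chainEquiv_map]⟩

lemma exists_mvδ_eq_iff (c : Homology n (U ∩ V : Set X)) :
    (∃ z, mvδ hU hV hUV n z = c) ↔
      map n (interLeft U V) c = 0 ∧ map n (interRight U V) c = 0 := by
  rw [← (chainEquiv n U).map_eq_zero_iff, ← (chainEquiv n V).map_eq_zero_iff, chainEquiv_map,
    chainEquiv_map,
    ← exists_squareδ_eq_iff (square_zero U V) (quasiIso_desc U V hU hV hUV)]
  constructor
  · rintro ⟨z, rfl⟩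
    exact ⟨_, (chainEquiv_mvδ hU hV hUV z).symm⟩
  · rintro ⟨z, hz⟩
    refine ⟨(chainEquiv (n + 1) X).symm z, (chainEquiv n _).injective ?_⟩
    rw [chainEquiv_mvδ, LinearEquiv.apply_symm_apply, hz]

include hU hV hUV in
lemma exists_inter_of_map_eq {a : Homology n U} {b : Homology n V}
    (h : map n (incl U) a = map n (incl V) b) :
    ∃ c, map n (interLeft U V) c = a ∧ map n (interRight U V) c = b := by
  have h' := congrArg (chainEquiv n X) h
  rw [chainEquiv_map, chainEquiv_map] at h'
  obtain ⟨c, hc1, hc2⟩ := exists_square_of_hmap_eq (square_zero U V)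
    (quasiIso_desc U V hU hV hUV) h'
  refine ⟨(chainEquiv n _).symm c, (chainEquiv n _).injective ?_, (chainEquiv n _).injective ?_⟩
  · rw [chainEquiv_map, LinearEquiv.apply_symm_apply, hc1]
  · rw [chainEquiv_map, LinearEquiv.apply_symm_apply, hc2]

include hU hV hUV in
lemma exists_eq_sub_of_zero (z : Homology 0 X) :
    ∃ a b, z = map 0 (incl U) a - map 0 (incl V) b := by
  obtain ⟨a, b, h⟩ := exists_eq_sub_of_homology_zero (square_zero U V)
    (quasiIso_desc U V hU hV hUV) (chainEquiv 0 X z)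
  refine ⟨(chainEquiv 0 U).symm a, (chainEquiv 0 V).symm b, (chainEquiv 0 X).injective ?_⟩
  rw [map_sub, chainEquiv_map, chainEquiv_map, LinearEquiv.apply_symm_apply,
    LinearEquiv.apply_symm_apply, h]

/-- The restriction of a continuous map to subspaces. -/
def _root_.restrictMap {X X' : Type} [TopologicalSpace X] [TopologicalSpace X'] (f : C(X, X'))
    {A : Set X} {A' : Set X'} (h : Set.MapsTo f A A') : C(A, A') :=
  ⟨h.restrict, f.continuous.restrict h⟩

lemma mvδ_naturality {X' : Type} [TopologicalSpace X'] {U' V' : Set X'} (hU' : IsOpen U')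
    (hV' : IsOpen V') (hUV' : U' ∪ V' = Set.univ) (f : C(X, X')) (hfU : Set.MapsTo f U U')
    (hfV : Set.MapsTo f V V') (z : Homology (n + 1) X) :
    map n (restrictMap f (hfU.inter_inter hfV)) (mvδ hU hV hUV n z) =
      mvδ hU' hV' hUV' n (map (n + 1) f z) := by
  apply (chainEquiv n _).injective
  rw [chainEquiv_map, chainEquiv_mvδ, chainEquiv_mvδ, chainEquiv_map]
  apply squareδ_naturality _ _ _ _ _ (chainMap (restrictMap f hfU)) (chainMap (restrictMap f hfV))
  all_goals
    rw [chainMap_comp, chainMap_comp]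
    rfl

end MayerVietoris

end Homology

end

/-! ### Homology of the empty space and the point, and degree zero -/

namespace Homology

open CategoryTheory MayerVietoris

lemma subsingleton_of_isEmpty (n : ℕ) (X : Type) [TopologicalSpace X] [IsEmpty X] :
    Subsingleton (Homology n X) := by
  have h1 : IsEmpty C(TopSimplex n, X) := ⟨fun σ => isEmptyElim (σ (TopSimplex.vertices n 0))⟩
  have h2 : Subsingleton (SingularChain n X) := inferInstance
  have h3 : ((chainsFunctor.obj (TopCat.of X)).ExactAt n) :=
    HomologicalComplex.ExactAt.of_isZero (@ModuleCat.isZero_of_subsingleton _ _ _ h2)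
  have h4 := ModuleCat.subsingleton_of_isZero h3.isZero_homology
  exact (chainEquiv n X).injective.subsingleton

lemma subsingleton_of_unique {n : ℕ} (hn : n ≠ 0) (X : Type) [TopologicalSpace X] [Unique X] :
    Subsingleton (Homology n X) :=
  ModuleCat.subsingleton_of_isZero
    (AlgebraicTopology.isZero_singularHomologyFunctor_of_totallyDisconnectedSpace
      (ModuleCat.{0} ℤ) n (ModuleCat.of ℤ ℤ) (TopCat.of X) hn)

/-- The zeroth homology of a path connected space. -/
noncomputable def zeroEquiv (X : Type) [TopologicalSpace X] [PathConnectedSpace X] :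
    Homology 0 X ≃ₗ[ℤ] ℤ :=
  have : PathConnectedSpace (TopCat.of X) := ‹_›
  (asIso (TopCat.singularHomology₀ε (TopCat.of X) (ModuleCat.of ℤ ℤ))).toLinearEquiv

section

variable {X Y : Type} [TopologicalSpace X] [TopologicalSpace Y]

/-- Both groups are $\mathbb Z$ and the map is split surjective by the choice of a point. A
surjective endomorphism of $\mathbb Z$ is injective, so naturality of `zeroEquiv` is not required.
-/
lemma map_zero_injective [PathConnectedSpace X] [Unique Y] (f : C(X, Y)) :
    Function.Injective (map 0 f) := by
  have x : X := Classical.arbitrary X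
  have hs : Function.Surjective (map 0 f) := fun y => by
    refine ⟨map 0 (ContinuousMap.const Y x) y, ?_⟩
    rw [map_map]
    convert map_id y
    ext
    exact Subsingleton.elim _ _
  have h := OrzechProperty.injective_of_surjective_endomorphism
    ((zeroEquiv Y).toLinearMap ∘ₗ map 0 f ∘ₗ (zeroEquiv X).symm.toLinearMap) ?_
  · intro a b hab
    obtain ⟨a, rfl⟩ := (zeroEquiv X).symm.surjective a
    obtain ⟨b, rfl⟩ := (zeroEquiv X).symm.surjective b
    exact congrArg _ (h (congrArg (zeroEquiv Y) hab))
  · exact (zeroEquiv Y).surjective.comp (hs.comp (zeroEquiv X).symm.surjective)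

lemma map_const {n : ℕ} (hn : n ≠ 0) (y : Y) (z : Homology n X) :
    map n (ContinuousMap.const X y) z = 0 := by
  have := subsingleton_of_unique hn Unit
  have h : ContinuousMap.const X y =
    (ContinuousMap.const Unit y).comp (ContinuousMap.const X ()) := rfl
  rw [h, ← map_map, Subsingleton.elim (map n (ContinuousMap.const X ()) z) 0, map_zero]

end

end Homology

/-! ### Products with the punctured line -/

/-- The complement of the origin. -/
abbrev Punctured (E : Type) [Zero E] : Type := {x : E // x ≠ 0}

namespace Homology

open MayerVietoris

/-- The kernel of the projection `X × P → X` on homology. -/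
noncomputable abbrev fibreKer (n : ℕ) (X P : Type) [TopologicalSpace X] [TopologicalSpace P] :
    Submodule ℤ (Homology n (X × P)) :=
  LinearMap.ker (map n (ContinuousMap.fst : C(X × P, X)))

/-- The map of products with a fixed second factor. -/
def prodMapLeft {X Y : Type} [TopologicalSpace X] [TopologicalSpace Y] (P : Type)
    [TopologicalSpace P] (f : C(X, Y)) : C(X × P, Y × P) := f.prodMap (ContinuousMap.id P)

lemma map_prodMapLeft_mem {X Y : Type} [TopologicalSpace X] [TopologicalSpace Y] {P : Type}
    [TopologicalSpace P] {n : ℕ} (f : C(X, Y)) {z : Homology n (X × P)} (hz : z ∈ fibreKer n X P) :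
    map n (prodMapLeft P f) z ∈ fibreKer n Y P := by
  rw [LinearMap.mem_ker] at hz ⊢
  rw [map_map]
  have : ContinuousMap.fst.comp (prodMapLeft P f) = f.comp ContinuousMap.fst := rfl
  rw [this, ← map_map, hz, map_zero]

/-- The map `X → X × P` with constant second component. -/
def slice (X : Type) [TopologicalSpace X] {P : Type} [TopologicalSpace P] (p : P) : C(X, X × P) :=
  (ContinuousMap.id X).prodMk (ContinuousMap.const X p)

lemma map_fst_slice {X P : Type} [TopologicalSpace X] [TopologicalSpace P] {n : ℕ} (p : P)
    (a : Homology n X) : map n ContinuousMap.fst (map n (slice X p) a) = a := by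
  rw [map_map]
  exact map_id a

/-- Straight-line homotopy in the vector-space coordinate, with the base coordinate fixed. The
embedding `ι` reduces continuity to that of the formula in `X × W`. -/
lemma homotopic_of_segment {X Y Z W : Type} [TopologicalSpace X] [TopologicalSpace Y]
    [TopologicalSpace Z] [NormedAddCommGroup W] [NormedSpace ℝ W] {ι : Z → X × W}
    (hι : Topology.IsEmbedding ι) (f g : C(Y, Z)) (h1 : ∀ y, (ι (f y)).1 = (ι (g y)).1)
    (h2 : ∀ y (s : ℝ), 0 ≤ s → s ≤ 1 →
      ((ι (f y)).1, (1 - s) • (ι (f y)).2 + s • (ι (g y)).2) ∈ Set.range ι) :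
    f.Homotopic g := by
  choose H hH using fun q : unitInterval × Y => h2 q.2 q.1 q.1.2.1 q.1.2.2
  have hι' := hι.continuous
  refine ⟨⟨⟨H, ?_⟩, fun y => hι.injective ?_, fun y => hι.injective ?_⟩⟩
  · rw [hι.continuous_iff, show ι ∘ H = _ from funext hH]
    fun_prop
  · rw [hH]
    simp
  · rw [hH]
    simp [h1]

lemma isEmbedding_val_punctured {X W : Type} [TopologicalSpace X] [NormedAddCommGroup W]
    {S : Set (X × Punctured W)} :
    Topology.IsEmbedding fun q : S => ((q.1.1, q.1.2.1) : X × W) :=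
  (Topology.IsEmbedding.id.prodMap Topology.IsEmbedding.subtypeVal).comp
    Topology.IsEmbedding.subtypeVal

section Base

variable (X : Type) [TopologicalSpace X]

/-- A nonzero real number, as a point of the punctured line. -/
def realPt {ε : ℝ} (hε : ε ≠ 0) : Punctured ℝ := ⟨ε, hε⟩

/-- The part of `X × Punctured ℝ` over a half line. -/
def halfLine (ε : ℝ) : Set (X × Punctured ℝ) := {q | 0 < ε * q.2.1}

variable {X}

lemma isOpen_halfLine (ε : ℝ) : IsOpen (halfLine X ε) :=
  isOpen_lt continuous_const (by fun_prop)

/-- The section of the projection from a half line. -/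
def halfLineSection (X : Type) [TopologicalSpace X] {ε : ℝ} (hε : ε ≠ 0) : C(X, halfLine X ε) :=
  ⟨fun a => ⟨slice X (realPt hε) a, mul_self_pos.2 hε⟩,
    (slice X (realPt hε)).continuous.subtype_mk _⟩

lemma segment_mem {ε a b s : ℝ} (ha : 0 < ε * a) (hb : 0 < ε * b) (h0 : 0 ≤ s) (h1 : s ≤ 1) :
    0 < ε * ((1 - s) • a + s • b) := by
  have h : ε * ((1 - s) • a + s • b) = (1 - s) * (ε * a) + s * (ε * b) := by
    simp only [smul_eq_mul]
    ring
  rw [h]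
  rcases h0.eq_or_lt with rfl | h0
  · simpa using ha
  · have := mul_pos h0 hb
    have := mul_nonneg (sub_nonneg.2 h1) ha.le
    linarith

lemma map_halfLine_bijective {ε : ℝ} (hε : ε ≠ 0) (n : ℕ) :
    Function.Bijective (map n ((ContinuousMap.fst : C(X × Punctured ℝ, X)).comp
      (incl (halfLine X ε)))) := by
  refine map_bijective_of_homotopic _ (halfLineSection X hε) ?_ ?_ n
  swap
  · exact ContinuousMap.Homotopic.refl (ContinuousMap.id X)
  refine homotopic_of_segment isEmbedding_val_punctured _ _ (fun _ => rfl) fun q s h0 h1 => ?_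
  have h := segment_mem (mul_self_pos.2 hε) q.2 h0 h1
  exact ⟨⟨(q.1.1, ⟨_, right_ne_zero_of_mul h.ne'⟩), h⟩, rfl⟩

omit [TopologicalSpace X] in
lemma halfLine_union : halfLine X 1 ∪ halfLine X (-1) = Set.univ := by
  refine Set.eq_univ_of_forall fun q => ?_
  rcases lt_or_gt_of_ne q.2.2 with h | h
  · exact Or.inr (by simpa [halfLine] using h)
  · exact Or.inl (by simpa [halfLine] using h)

instance isEmpty_halfLine_inter : IsEmpty (halfLine X 1 ∩ halfLine X (-1) : Set _) := by
  refine ⟨fun q => ?_⟩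
  have h1 : 0 < 1 * q.1.2.1 := q.2.1
  have h2 : 0 < -1 * q.1.2.1 := q.2.2
  linarith

/-- The two half lines are disjoint and cover the punctured line, so every class is a difference of
classes from the two pieces; each piece retracts to a slice. -/
lemma exists_eq_map_slice_sub {n : ℕ} (z : Homology n (X × Punctured ℝ)) :
    ∃ a b, z = map n (slice X (realPt one_ne_zero)) a -
      map n (slice X (realPt (neg_ne_zero.2 one_ne_zero))) b := by
  have h : ∃ a b, z = map n (incl (halfLine X 1)) a - map n (incl (halfLine X (-1))) b := by
    cases n with
    | zero =>
      exact exists_eq_sub_of_zero (isOpen_halfLine 1) (isOpen_halfLine (-1)) halfLine_union z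
    | succ n =>
      rw [← mvδ_eq_zero_iff (isOpen_halfLine 1) (isOpen_halfLine (-1)) halfLine_union]
      have := subsingleton_of_isEmpty n (halfLine X 1 ∩ halfLine X (-1) : Set _)
      exact Subsingleton.elim _ _
  obtain ⟨a, b, rfl⟩ := h
  have hs : ∀ {ε : ℝ} (hε : ε ≠ 0) (a : Homology n (halfLine X ε)),
      map n (incl (halfLine X ε)) a = map n (slice X (realPt hε)) (map n (ContinuousMap.fst.comp
        (incl (halfLine X ε))) a) := by
    intro ε hε a
    have h1 : slice X (realPt hε) = (incl (halfLine X ε)).comp (halfLineSection X hε) := rfl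
    rw [h1, ← map_map _ (incl (halfLine X ε))]
    congr 1
    refine (map_halfLine_bijective hε n).1 ?_
    rw [map_map, map_map]
    rfl
  exact ⟨_, _, congrArg₂ _ (hs _ a) (hs _ b)⟩

lemma map_slice_sub_mem {n : ℕ} {P : Type} [TopologicalSpace P] (p q : P) (a : Homology n X) :
    map n (slice X p) a - map n (slice X q) a ∈ fibreKer n X P := by
  rw [LinearMap.mem_ker, map_sub, map_fst_slice, map_fst_slice, sub_self]

/-- The difference of the two slices of `X × Punctured ℝ`. -/
noncomputable def baseMap (n : ℕ) (X : Type) [TopologicalSpace X] :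
    Homology n X →+ fibreKer n X (Punctured ℝ) where
  toFun a := ⟨_, map_slice_sub_mem (realPt one_ne_zero) (realPt (neg_ne_zero.2 one_ne_zero)) a⟩
  map_zero' := Subtype.ext (by simp)
  map_add' a b := Subtype.ext (by simp only [map_add, Submodule.coe_add]; abel)

lemma coe_baseMap (n : ℕ) (X : Type) [TopologicalSpace X] (a : Homology n X) :
    (baseMap n X a : Homology n (X × Punctured ℝ)) = map n (slice X (realPt one_ne_zero)) a -
      map n (slice X (realPt (neg_ne_zero.2 one_ne_zero))) a := rfl

/-- If the two slices of `a` agree, Mayer-Vietoris lifts them to the empty intersection, so `a`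
vanishes. Conversely a difference of slices of `a` and `b` projects to `a - b`, so lying in the
kernel means `a = b`. -/
lemma baseMap_bijective (n : ℕ) (X : Type) [TopologicalSpace X] :
    Function.Bijective (baseMap n X) := by
  constructor
  · rw [injective_iff_map_eq_zero]
    intro a ha
    have ha' := congrArg Subtype.val ha
    rw [coe_baseMap, Submodule.coe_zero] at ha'
    have h1 : ∀ {ε : ℝ} (hε : ε ≠ 0), map n (slice X (realPt hε)) a =
        map n (incl (halfLine X ε)) (map n (halfLineSection X hε) a) := by
      intro ε hε
      rw [map_map]
      rfl
    rw [sub_eq_zero, h1, h1] at ha'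
    obtain ⟨c, hc, -⟩ := exists_inter_of_map_eq (isOpen_halfLine 1) (isOpen_halfLine (-1))
      halfLine_union ha'
    have := subsingleton_of_isEmpty n (halfLine X 1 ∩ halfLine X (-1) : Set _)
    rw [Subsingleton.elim c 0, map_zero] at hc
    rw [← map_fst_slice (P := Punctured ℝ) (realPt one_ne_zero) a, h1, ← hc, map_zero, map_zero]
  · rintro ⟨z, hz⟩
    obtain ⟨a, b, rfl⟩ := exists_eq_map_slice_sub z
    rw [LinearMap.mem_ker, map_sub, map_fst_slice, map_fst_slice, sub_eq_zero] at hz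
    subst hz
    exact ⟨a, rfl⟩

/-- The homology of `X × Punctured ℝ`. -/
noncomputable def baseEquiv (n : ℕ) (X : Type) [TopologicalSpace X] :
    Homology n X ≃+ fibreKer n X (Punctured ℝ) :=
  AddEquiv.ofBijective (baseMap n X) (baseMap_bijective n X)

lemma map_prodMapLeft_baseEquiv {Y : Type} [TopologicalSpace Y] {n : ℕ} (f : C(X, Y))
    (a : Homology n X) :
    map n (prodMapLeft (Punctured ℝ) f) (baseEquiv n X a).1 = (baseEquiv n Y (map n f a)).1 := by
  refine (congrArg _ (coe_baseMap n X a)).trans (.trans ?_ (coe_baseMap n Y _).symm)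
  rw [map_sub, map_map, map_map, map_map, map_map]
  rfl

end Base

end Homology

/-! ### The suspension isomorphism for products with punctured spaces -/

namespace Homology

open MayerVietoris

lemma slice_homotopic {X P : Type} [TopologicalSpace X] [TopologicalSpace P] {p q : P}
    (h : Joined p q) : (slice X p).Homotopic (slice X q) := by
  obtain ⟨γ⟩ := h
  exact ⟨⟨⟨fun a => (a.2, γ a.1), by fun_prop⟩, fun a => by simp [slice], fun a => by simp [slice]⟩⟩

instance pathConnectedSpace_punctured {E : Type} [NormedAddCommGroup E] [NormedSpace ℝ E]
    [Nontrivial E] : PathConnectedSpace (Punctured (E × ℝ)) := by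
  have h : (1 : Cardinal) < Module.rank ℝ (E × ℝ) := by
    have h1 : (1 : Cardinal) ≤ Module.rank ℝ E := Cardinal.one_le_iff_pos.2 rank_pos
    rw [rank_prod', Module.rank_self]
    refine lt_of_lt_of_le ?_ (add_le_add_left h1 1)
    norm_num
  exact isPathConnected_iff_pathConnectedSpace.1 (isPathConnected_compl_singleton_of_one_lt_rank h 0)

section Suspension

variable (X E : Type) [TopologicalSpace X] [NormedAddCommGroup E] [NormedSpace ℝ E]

/-- The pole of the suspension of `Punctured E` on the side of `ε`. -/
def pole {ε : ℝ} (hε : ε ≠ 0) : Punctured (E × ℝ) := ⟨(0, ε), fun h => hε (congrArg Prod.snd h)⟩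

/-- The part of `X × Punctured (E × ℝ)` over the complement of one pole. -/
def conePart (ε : ℝ) : Set (X × Punctured (E × ℝ)) := {q | q.2.1.1 ≠ 0 ∨ 0 < ε * q.2.1.2}

variable {X E}

lemma isOpen_conePart (ε : ℝ) : IsOpen (conePart X E ε) :=
  (isOpen_ne_fun (f := fun q : X × Punctured (E × ℝ) => q.2.1.1) (by fun_prop)
    continuous_const).union
    (isOpen_lt (g := fun q : X × Punctured (E × ℝ) => ε * q.2.1.2) continuous_const (by fun_prop))

lemma conePart_union : conePart X E 1 ∪ conePart X E (-1) = Set.univ := by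
  refine Set.eq_univ_of_forall fun q => ?_
  by_cases h : q.2.1.1 = 0
  · have h' : q.2.1.2 ≠ 0 := fun h' => q.2.2 (Prod.ext h h')
    rcases lt_or_gt_of_ne h' with h | h
    · exact Or.inr (Or.inr (by simpa using h))
    · exact Or.inl (Or.inr (by simpa using h))
  · exact Or.inl (Or.inl h)

lemma fst_ne_zero_of_mem {q : X × Punctured (E × ℝ)} (h1 : q ∈ conePart X E 1)
    (h2 : q ∈ conePart X E (-1)) : q.2.1.1 ≠ 0 := by
  rcases h1 with h1 | h1
  · exact h1
  · rcases h2 with h2 | h2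
    · exact h2
    · linarith

/-- The section of the projection of `conePart` through the pole. -/
def coneSection (X E : Type) [TopologicalSpace X] [NormedAddCommGroup E] [NormedSpace ℝ E] {ε : ℝ}
    (hε : ε ≠ 0) : C(X, conePart X E ε) :=
  ⟨fun a => ⟨slice X (pole E hε) a, Or.inr (mul_self_pos.2 hε)⟩,
    (slice X (pole E hε)).continuous.subtype_mk _⟩

/-- The segment to the pole stays in the cone: before its end a nonzero equatorial component stays
nonzero, and a height of the right sign keeps its sign. -/
lemma map_conePart_bijective {ε : ℝ} (hε : ε ≠ 0) (n : ℕ) :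
    Function.Bijective (map n ((ContinuousMap.fst : C(X × Punctured (E × ℝ), X)).comp
      (incl (conePart X E ε)))) := by
  refine map_bijective_of_homotopic _ (coneSection X E hε) ?_ ?_ n
  swap
  · exact ContinuousMap.Homotopic.refl (ContinuousMap.id X)
  refine ContinuousMap.Homotopic.symm ?_
  refine homotopic_of_segment isEmbedding_val_punctured _ _ (fun _ => rfl) fun q s h0 h1 => ?_
  set w : E × ℝ := (1 - s) • q.1.2.1 + s • ((0 : E), ε) with hw
  have h : w.1 ≠ 0 ∨ 0 < ε * w.2 := by
    rcases h1.eq_or_lt with rfl | h1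
    · right
      simpa [hw] using mul_self_pos.2 hε
    · rcases q.2 with h | h
      · left
        simpa [hw, sub_eq_zero, h1.ne'] using h
      · exact Or.inr (segment_mem h (mul_self_pos.2 hε) h0 h1.le)
  have h' : w ≠ 0 := by
    rintro h'
    rw [h'] at h
    simp at h
  exact ⟨⟨(q.1.1, ⟨w, h'⟩), h⟩, rfl⟩

variable (X E) in
/-- The projection of the intersection of the two cones to the equator. -/
def toEquator : C((conePart X E 1 ∩ conePart X E (-1) : Set _), X × Punctured E) :=
  ⟨fun q => (q.1.1, ⟨q.1.2.1.1, fst_ne_zero_of_mem q.2.1 q.2.2⟩), by fun_prop⟩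

variable (X E) in
/-- The inclusion of the equator in the intersection of the two cones. -/
def ofEquator : C(X × Punctured E, (conePart X E 1 ∩ conePart X E (-1) : Set _)) :=
  ⟨fun q => ⟨(q.1, ⟨(q.2.1, 0), fun h => q.2.2 (congrArg Prod.fst h)⟩), Or.inl q.2.2,
    Or.inl q.2.2⟩, by fun_prop⟩

lemma map_toEquator_bijective (n : ℕ) : Function.Bijective (map n (toEquator X E)) := by
  refine map_bijective_of_homotopic _ (ofEquator X E) ?_ ?_ n
  swap
  · exact ContinuousMap.Homotopic.refl (ContinuousMap.id _)
  refine ContinuousMap.Homotopic.symm ?_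
  refine homotopic_of_segment isEmbedding_val_punctured _ _ (fun _ => rfl) fun q s h0 h1 => ?_
  set w : E × ℝ := (1 - s) • q.1.2.1 + s • (q.1.2.1.1, 0) with hw
  have h : w.1 ≠ 0 := by
    have h2 : w.1 = q.1.2.1.1 := by
      change (1 - s) • q.1.2.1.1 + s • q.1.2.1.1 = q.1.2.1.1
      rw [← add_smul, sub_add_cancel, one_smul]
    rw [h2]
    exact fst_ne_zero_of_mem q.2.1 q.2.2
  exact ⟨⟨(q.1.1, ⟨w, fun h' => h (congrArg Prod.fst h')⟩), Or.inl h, Or.inl h⟩, rfl⟩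

/-- The Mayer-Vietoris connecting map, with values in the homology of the equator. -/
noncomputable def equatorδ (n : ℕ) (X E : Type) [TopologicalSpace X] [NormedAddCommGroup E]
    [NormedSpace ℝ E] :
    Homology (n + 1) (X × Punctured (E × ℝ)) →ₗ[ℤ] Homology n (X × Punctured E) :=
  map n (toEquator X E) ∘ₗ mvδ (isOpen_conePart 1) (isOpen_conePart (-1)) conePart_union n

lemma equatorδ_mem {n : ℕ} (z : Homology (n + 1) (X × Punctured (E × ℝ))) :
    equatorδ n X E z ∈ fibreKer n X (Punctured E) := by
  rw [LinearMap.mem_ker, equatorδ, LinearMap.comp_apply, map_map]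
  have h1 : ContinuousMap.fst.comp (toEquator X E) =
    ((ContinuousMap.fst.comp (incl (conePart X E 1))).comp (interLeft _ _)) := rfl
  rw [h1, ← map_map, ((exists_mvδ_eq_iff (isOpen_conePart 1) (isOpen_conePart (-1)) conePart_union
    _).1 ⟨z, rfl⟩).1, map_zero]

lemma map_incl_conePart {ε : ℝ} (hε : ε ≠ 0) {n : ℕ} (a : Homology n (conePart X E ε)) :
    map n (incl (conePart X E ε)) a = map n (slice X (pole E hε)) (map n (ContinuousMap.fst.comp
      (incl (conePart X E ε))) a) := by
  have h1 : slice X (pole E hε) = (incl (conePart X E ε)).comp (coneSection X E hε) := rfl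
  rw [h1, ← map_map _ (incl (conePart X E ε))]
  congr 1
  refine (map_conePart_bijective hε n).1 ?_
  rw [map_map, map_map]
  rfl

/-- Such a class is a difference of two polar slices, of one and the same base class by the kernel
condition. The poles are joined by a path since `E` is nontrivial, so the slices cancel. -/
lemma eq_zero_of_equatorδ_eq_zero [Nontrivial E] {n : ℕ}
    {z : Homology (n + 1) (X × Punctured (E × ℝ))} (hz : z ∈ fibreKer (n + 1) X _)
    (h : equatorδ n X E z = 0) : z = 0 := by
  rw [equatorδ, LinearMap.comp_apply, (map_eq_zero_iff _ (map_toEquator_bijective n).1),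
    mvδ_eq_zero_iff] at h
  obtain ⟨a, b, rfl⟩ := h
  rw [map_incl_conePart one_ne_zero, map_incl_conePart (neg_ne_zero.2 one_ne_zero)] at hz ⊢
  rw [LinearMap.mem_ker, map_sub, map_fst_slice, map_fst_slice, sub_eq_zero] at hz
  rw [hz, sub_eq_zero]
  exact map_eq_of_homotopic (slice_homotopic (PathConnectedSpace.joined _ _)) _

/-- Each cone has the homology of `X`, so a class that dies in `X` dies in both cones and is a
boundary value. -/
lemma exists_equatorδ_eq {n : ℕ} {c : Homology n (X × Punctured E)}
    (hc : c ∈ fibreKer n X (Punctured E)) :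
    ∃ z ∈ fibreKer (n + 1) X _, equatorδ n X E z = c := by
  obtain ⟨c, rfl⟩ := (map_toEquator_bijective n).2 c
  rw [LinearMap.mem_ker, map_map] at hc
  obtain ⟨z, rfl⟩ : ∃ z, mvδ (isOpen_conePart 1) (isOpen_conePart (-1)) conePart_union n z = c := by
    rw [exists_mvδ_eq_iff]
    constructor
    · refine (map_conePart_bijective one_ne_zero n).1 ?_
      rw [map_map, map_zero]
      exact hc
    · refine (map_conePart_bijective (neg_ne_zero.2 one_ne_zero) n).1 ?_
      rw [map_map, map_zero]
      exact hc
  -- Subtracting the polar slice of the projection puts `z` in the kernel. The boundary value is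
  -- unchanged, because this slice comes from one of the cones.
  refine ⟨z - map _ (slice X (pole E one_ne_zero)) (map _ ContinuousMap.fst z), ?_, ?_⟩
  · rw [LinearMap.mem_ker, map_sub, map_fst_slice, sub_self]
  · have h : mvδ (isOpen_conePart 1) (isOpen_conePart (-1)) conePart_union n
        (map (n + 1) (slice X (pole E one_ne_zero)) (map _ ContinuousMap.fst z)) = 0 := by
      rw [mvδ_eq_zero_iff]
      refine ⟨map (n + 1) (coneSection X E one_ne_zero) (map _ ContinuousMap.fst z), 0, ?_⟩
      rw [map_zero, sub_zero, map_map (coneSection X E one_ne_zero)]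
      rfl
    rw [equatorδ, LinearMap.comp_apply, map_sub, h, sub_zero]

/-- The suspension map. -/
noncomputable def suspMap (n : ℕ) (X E : Type) [TopologicalSpace X] [NormedAddCommGroup E]
    [NormedSpace ℝ E] :
    fibreKer (n + 1) X (Punctured (E × ℝ)) →+ fibreKer n X (Punctured E) where
  toFun z := ⟨equatorδ n X E z.1, equatorδ_mem z.1⟩
  map_zero' := Subtype.ext (map_zero (equatorδ n X E))
  map_add' a b := Subtype.ext (map_add (equatorδ n X E) a.1 b.1)

lemma suspMap_bijective [Nontrivial E] (n : ℕ) : Function.Bijective (suspMap n X E) := by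
  constructor
  · rw [injective_iff_map_eq_zero]
    intro z hz
    exact Subtype.ext (eq_zero_of_equatorδ_eq_zero z.2 (congrArg Subtype.val hz))
  · rintro ⟨c, hc⟩
    obtain ⟨z, hz, rfl⟩ := exists_equatorδ_eq hc
    exact ⟨⟨z, hz⟩, rfl⟩

/-- The suspension isomorphism. -/
noncomputable def suspEquiv (n : ℕ) (X E : Type) [TopologicalSpace X] [NormedAddCommGroup E]
    [NormedSpace ℝ E] [Nontrivial E] :
    fibreKer (n + 1) X (Punctured (E × ℝ)) ≃+ fibreKer n X (Punctured E) :=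
  AddEquiv.ofBijective (suspMap n X E) (suspMap_bijective n)

lemma coe_suspEquiv [Nontrivial E] {n : ℕ} (z : fibreKer (n + 1) X (Punctured (E × ℝ))) :
    (suspEquiv n X E z : Homology n (X × Punctured E)) = equatorδ n X E z := rfl

lemma map_prodMapLeft_equatorδ {Y : Type} [TopologicalSpace Y] {n : ℕ} (f : C(X, Y))
    (z : Homology (n + 1) (X × Punctured (E × ℝ))) :
    map n (prodMapLeft (Punctured E) f) (equatorδ n X E z) =
      equatorδ n Y E (map (n + 1) (prodMapLeft (Punctured (E × ℝ)) f) z) := by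
  rw [equatorδ, LinearMap.comp_apply, equatorδ, LinearMap.comp_apply,
    ← mvδ_naturality (isOpen_conePart 1) (isOpen_conePart (-1)) conePart_union _ _ _
      (prodMapLeft (Punctured (E × ℝ)) f) (fun _ h => h) (fun _ h => h), map_map, map_map]
  rfl

end Suspension

end Homology

/-! ### Products with $\mathbb R^3\setminus0$ and $\mathbb R^4\setminus0$ -/

namespace Homology

variable {X Y P : Type} [TopologicalSpace X] [TopologicalSpace Y] [TopologicalSpace P]

lemma subsingleton_prod {n : ℕ} [Nonempty P] (h1 : Subsingleton (Homology n X))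
    (h2 : Subsingleton (fibreKer n X P)) : Subsingleton (Homology n (X × P)) := by
  refine subsingleton_of_forall_eq 0 fun z => ?_
  have hz : z ∈ fibreKer n X P := Subsingleton.elim _ _
  exact congrArg Subtype.val (Subsingleton.elim (⟨z, hz⟩ : fibreKer n X P) 0)

/-- If the homology of the base vanishes, the homology of a product is `fibreKer`. -/
noncomputable def fibreKerEquiv {n : ℕ} (X P : Type) [TopologicalSpace X] [TopologicalSpace P]
    (h : Subsingleton (Homology n X)) : Homology n (X × P) ≃+ fibreKer n X P where
  toFun z := ⟨z, Subsingleton.elim _ _⟩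
  invFun z := z.1
  left_inv _ := rfl
  right_inv _ := rfl
  map_add' _ _ := rfl

/-- Homeomorphic spaces have the same homology. -/
noncomputable def equivOfHomeomorph (n : ℕ) (e : X ≃ₜ Y) : Homology n X ≃ₗ[ℤ] Homology n Y :=
  equivOfHomotopic (e : C(X, Y)) (e.symm : C(Y, X))
    (by rw [show ContinuousMap.comp _ _ = _ from e.symm_comp_toContinuousMap])
    (by rw [show ContinuousMap.comp _ _ = _ from e.toContinuousMap_comp_symm]) n

/-- The homology of a fibre over a point. -/
noncomputable def pointEquiv {n : ℕ} (hn : n ≠ 0) (P : Type) [TopologicalSpace P] :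
    Homology n P ≃+ fibreKer n Unit P :=
  (equivOfHomeomorph n (Homeomorph.punitProd P).symm).toAddEquiv.trans
    (fibreKerEquiv Unit P (subsingleton_of_unique hn Unit))

lemma subsingleton_fibreKer_zero [PathConnectedSpace X] [PathConnectedSpace P] :
    Subsingleton (fibreKer 0 X P) := by
  have h : Function.Injective (map 0 (ContinuousMap.fst : C(X × P, X))) := by
    have : Function.Injective (map 0 (ContinuousMap.const X ()) ∘
        map 0 (ContinuousMap.fst : C(X × P, X))) := by
      convert map_zero_injective (ContinuousMap.const (X × P) ()) using 1
      ext z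
      exact map_map _ _ _
    exact this.of_comp
  exact subsingleton_of_forall_eq 0 fun z => Subtype.ext (h (by rw [z.2]; exact (map_zero _).symm))

/-- The punctured `3`-space. -/
abbrev Punctured3 : Type := Punctured ((ℝ × ℝ) × ℝ)

/-- The punctured `4`-space. -/
abbrev Punctured4 : Type := Punctured (((ℝ × ℝ) × ℝ) × ℝ)

/-- The homology of `X × ℝ³ \ 0` relative to that of `X`. -/
noncomputable def fibreKer3Equiv (n : ℕ) (X : Type) [TopologicalSpace X] :
    fibreKer (n + 2) X Punctured3 ≃+ Homology n X :=
  ((suspEquiv (n + 1) X (ℝ × ℝ)).trans (suspEquiv n X ℝ)).trans (baseEquiv n X).symm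

/-- The homology of `X × ℝ⁴ \ 0` relative to that of `X`. -/
noncomputable def fibreKer4Equiv (n : ℕ) (X : Type) [TopologicalSpace X] :
    fibreKer (n + 3) X Punctured4 ≃+ Homology n X :=
  (suspEquiv (n + 2) X ((ℝ × ℝ) × ℝ)).trans (fibreKer3Equiv n X)

lemma fibreKer4Equiv_map {n : ℕ} (f : C(X, Y)) (z : fibreKer (n + 3) X Punctured4) :
    fibreKer4Equiv n Y ⟨map (n + 3) (prodMapLeft Punctured4 f) z.1, map_prodMapLeft_mem f z.2⟩ =
      map n f (fibreKer4Equiv n X z) := by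
  -- The base isomorphism is explicit only in the upward direction, so `z` is written as the image
  -- of a class `a` of the base.
  obtain ⟨w, rfl⟩ := (suspEquiv (n + 2) X ((ℝ × ℝ) × ℝ)).symm.surjective z
  obtain ⟨w, rfl⟩ := (suspEquiv (n + 1) X (ℝ × ℝ)).symm.surjective w
  obtain ⟨w, rfl⟩ := (suspEquiv n X ℝ).symm.surjective w
  obtain ⟨a, rfl⟩ := (baseEquiv n X).surjective w
  simp only [fibreKer4Equiv, fibreKer3Equiv, AddEquiv.trans_apply, AddEquiv.apply_symm_apply,
    AddEquiv.symm_apply_apply]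
  rw [AddEquiv.symm_apply_eq]
  refine Subtype.ext ?_
  rw [← map_prodMapLeft_baseEquiv]
  simp only [coe_suspEquiv, ← map_prodMapLeft_equatorδ]
  congr 1
  have h (m : ℕ) (E : Type) [NormedAddCommGroup E] [NormedSpace ℝ E] [Nontrivial E]
      (z : fibreKer m X (Punctured E)) :
      equatorδ m X E ((suspEquiv m X E).symm z).1 = z := by
    rw [← coe_suspEquiv, AddEquiv.apply_symm_apply]
  rw [h, h, h]

lemma map_prodMapLeft_injective {n : ℕ} {f : C(X, Y)} (hf : Function.Injective (map n f))
    {z : Homology (n + 3) (X × Punctured4)} (hz : z ∈ fibreKer (n + 3) X Punctured4)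
    (h : map (n + 3) (prodMapLeft Punctured4 f) z = 0) : z = 0 := by
  have h1 := fibreKer4Equiv_map f ⟨z, hz⟩
  rw [show (⟨_, _⟩ : fibreKer (n + 3) Y Punctured4) = 0 from Subtype.ext h, map_zero] at h1
  have h2 := (map_eq_zero_iff _ hf).1 h1.symm
  exact congrArg Subtype.val ((map_eq_zero_iff _ (AddEquiv.injective _)).1 h2)

/-- The third homology of the punctured `4`-space. -/
noncomputable def punctured4Equiv : Homology 3 Punctured4 ≃+ ℤ :=
  ((pointEquiv (by norm_num) Punctured4).trans (fibreKer4Equiv 0 Unit)).trans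
    (zeroEquiv Unit).toAddEquiv

lemma subsingleton_punctured4_five : Subsingleton (Homology 5 Punctured4) :=
  have := subsingleton_of_unique two_ne_zero Unit
  ((pointEquiv (by norm_num) Punctured4).trans (fibreKer4Equiv 2 Unit)).injective.subsingleton

/-- Two suspensions bring the degree down to 0; a third would make it negative, so connectedness of
$\mathbb R^2\setminus0$ is used instead. -/
lemma subsingleton_punctured4_two : Subsingleton (Homology 2 Punctured4) := by
  have : Subsingleton (fibreKer 0 Unit (Punctured (ℝ × ℝ))) := subsingleton_fibreKer_zero
  exact ((pointEquiv two_ne_zero Punctured4).trans ((suspEquiv 1 Unit ((ℝ × ℝ) × ℝ)).trans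
    (suspEquiv 0 Unit (ℝ × ℝ)))).injective.subsingleton

end Homology

/-! ### Unit quaternions and conjugacy in SU(2) -/

/-- Real coordinates of a quaternion, with the real part last. -/
abbrev QuatCoord : Type := ((ℝ × ℝ) × ℝ) × ℝ

namespace QuatCoord

/-- The squared length of an imaginary quaternion. -/
def imSq (v : (ℝ × ℝ) × ℝ) : ℝ := v.1.1 ^ 2 + v.1.2 ^ 2 + v.2 ^ 2

/-- The squared length of a quaternion. -/
def lenSq (q : QuatCoord) : ℝ := imSq q.1 + q.2 ^ 2

lemma imSq_pos {v : (ℝ × ℝ) × ℝ} (h : v ≠ 0) : 0 < imSq v := by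
  have h' : v.1.1 ≠ 0 ∨ v.1.2 ≠ 0 ∨ v.2 ≠ 0 := by
    by_contra! h'
    exact h (Prod.ext (Prod.ext h'.1 h'.2.1) h'.2.2)
  unfold imSq
  rcases h' with h' | h' | h' <;> positivity

lemma imSq_smul (r : ℝ) (v : (ℝ × ℝ) × ℝ) : imSq (r • v) = r ^ 2 * imSq v := by
  simp only [imSq, Prod.smul_fst, Prod.smul_snd, smul_eq_mul]
  ring

lemma lenSq_smul (r : ℝ) (q : QuatCoord) : lenSq (r • q) = r ^ 2 * lenSq q := by
  simp only [lenSq, imSq, Prod.smul_fst, Prod.smul_snd, smul_eq_mul]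
  ring

lemma lenSq_pos {q : QuatCoord} (h : q ≠ 0) : 0 < lenSq q := by
  rcases eq_or_ne q.1 0 with h1 | h1
  · have h2 : q.2 ≠ 0 := fun h2 => h (Prod.ext h1 h2)
    simp only [lenSq, h1, imSq, Prod.fst_zero, Prod.snd_zero]
    positivity
  · have := imSq_pos h1
    unfold lenSq
    positivity

lemma continuous_imSq : Continuous imSq := by
  unfold imSq
  fun_prop

lemma continuous_lenSq : Continuous lenSq := by
  unfold lenSq imSq
  fun_prop

/-- The complex matrix of a quaternion. -/
def toMatrix (q : QuatCoord) : Matrix (Fin 2) (Fin 2) ℂ :=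
  !![⟨q.2, q.1.1.1⟩, ⟨-q.1.1.2, q.1.2⟩; ⟨q.1.1.2, q.1.2⟩, ⟨q.2, -q.1.1.1⟩]

/-- The coordinates of a complex matrix that represents a quaternion. -/
def ofMatrix (A : Matrix (Fin 2) (Fin 2) ℂ) : QuatCoord :=
  ((((A 0 0).im, (A 1 0).re), (A 1 0).im), (A 0 0).re)

lemma ofMatrix_toMatrix (q : QuatCoord) : ofMatrix q.toMatrix = q := by
  simp [ofMatrix, toMatrix]

lemma toMatrix_sub (q r : QuatCoord) : (q - r).toMatrix = q.toMatrix - r.toMatrix := by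
  ext i j
  fin_cases i <;> fin_cases j <;> simp [toMatrix, Complex.ext_iff] <;> ring

lemma toMatrix_add (q r : QuatCoord) : (q + r).toMatrix = q.toMatrix + r.toMatrix := by
  ext i j
  fin_cases i <;> fin_cases j <;> simp [toMatrix, Complex.ext_iff] <;> ring

lemma toMatrix_smul (r : ℝ) (q : QuatCoord) : (r • q).toMatrix = r • q.toMatrix := by
  ext i j
  fin_cases i <;> fin_cases j <;> simp [toMatrix, Complex.ext_iff]

lemma continuous_toMatrix : Continuous toMatrix := by
  refine continuous_matrix fun i j => ?_
  rw [← Complex.equivRealProdCLM.comp_continuous_iff]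
  fin_cases i <;> fin_cases j <;> simp [toMatrix, Function.comp_def] <;> constructor <;> fun_prop

lemma continuous_ofMatrix : Continuous ofMatrix := by
  have h (i j : Fin 2) : Continuous fun A : Matrix (Fin 2) (Fin 2) ℂ => A i j := by fun_prop
  have hr := fun i j => Complex.continuous_re.comp (h i j)
  have hi := fun i j => Complex.continuous_im.comp (h i j)
  exact (((hi 0 0).prodMk (hr 1 0)).prodMk (hi 1 0)).prodMk (hr 0 0)

lemma det_toMatrix (q : QuatCoord) : q.toMatrix.det = lenSq q := by
  rw [Matrix.det_fin_two]
  apply Complex.ext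
  · simp [toMatrix, lenSq, imSq, -Complex.ofReal_add, -Complex.ofReal_pow]
    ring
  · simp [toMatrix, lenSq, imSq, -Complex.ofReal_add, -Complex.ofReal_pow]
    ring

lemma toMatrix_mem {q : QuatCoord} (h : lenSq q = 1) :
    q.toMatrix ∈ Matrix.specialUnitaryGroup (Fin 2) ℂ := by
  rw [Matrix.mem_specialUnitaryGroup_iff, det_toMatrix, h, Matrix.mem_unitaryGroup_iff]
  refine ⟨?_, by simp⟩
  simp only [lenSq, imSq] at h
  ext i j
  fin_cases i <;> fin_cases j <;>
    simp [toMatrix, Matrix.mul_apply, Fin.sum_univ_two, Complex.ext_iff] <;>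
    (try constructor) <;> linarith

end QuatCoord

namespace SU2

open QuatCoord

/-- The quaternion coordinates of an element of `SU2`. -/
def coord (A : SU2) : QuatCoord := ofMatrix A.1

lemma continuous_coord : Continuous coord := continuous_ofMatrix.comp continuous_subtype_val

lemma toMatrix_coord (A : SU2) : (coord A).toMatrix = A.1 := by
  obtain ⟨A, hA⟩ := A
  rw [Matrix.mem_specialUnitaryGroup_iff, Matrix.mem_unitaryGroup_iff'] at hA
  -- For a unitary matrix of determinant one the inverse is both the adjoint and the adjugate;
  -- comparing entries gives the quaternion form.
  have h1 : star A = A.adjugate := by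
    have h2 : A * A.adjugate = 1 := by rw [Matrix.mul_adjugate, hA.2, one_smul]
    rw [← mul_one (star A), ← h2, ← mul_assoc, hA.1, one_mul]
  rw [Matrix.adjugate_fin_two] at h1
  have h3 := congrFun₂ h1 0 0
  have h4 := congrFun₂ h1 0 1
  simp [Matrix.star_apply, Complex.ext_iff] at h3 h4
  ext i j
  fin_cases i <;> fin_cases j <;> simp [toMatrix, coord, ofMatrix, Complex.ext_iff, h3]
  all_goals grind

lemma coord_injective : Function.Injective coord := fun A B h =>
  Subtype.ext (by rw [← toMatrix_coord, h, toMatrix_coord])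

lemma lenSq_coord (A : SU2) : lenSq (coord A) = 1 := by
  have h := det_toMatrix (coord A)
  rw [toMatrix_coord, (Matrix.mem_specialUnitaryGroup_iff.1 A.2).2] at h
  exact_mod_cast h.symm

/-- The element of `SU2` with given quaternion coordinates. -/
def ofCoord (q : QuatCoord) (h : lenSq q = 1) : SU2 := ⟨q.toMatrix, toMatrix_mem h⟩

lemma coord_ofCoord (q : QuatCoord) (h : lenSq q = 1) : coord (ofCoord q h) = q := ofMatrix_toMatrix q

lemma coord_ne_zero (A : SU2) : coord A ≠ 0 := fun h => by
  have := lenSq_coord A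
  rw [h] at this
  simp [lenSq, imSq] at this

lemma lenSq_normalize {q : QuatCoord} (h : q ≠ 0) : lenSq ((√(lenSq q))⁻¹ • q) = 1 := by
  have := lenSq_pos h
  rw [lenSq_smul, inv_pow, Real.sq_sqrt this.le, inv_mul_cancel₀ this.ne']

/-- The radial projection. -/
noncomputable def normalize : C(Homology.Punctured4, SU2) :=
  ⟨fun q => ofCoord _ (lenSq_normalize q.2), by
    refine Continuous.subtype_mk (continuous_toMatrix.comp ?_) _
    have h := continuous_lenSq.comp (continuous_subtype_val (p := fun q : QuatCoord => q ≠ 0))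
    refine Continuous.smul (Continuous.inv₀ h.sqrt fun q => ?_) continuous_subtype_val
    exact (Real.sqrt_pos.2 (lenSq_pos q.2)).ne'⟩

/-- The inclusion of `SU2` in the nonzero quaternions. -/
def toPunctured : C(SU2, Homology.Punctured4) :=
  ⟨fun A => ⟨coord A, coord_ne_zero A⟩, continuous_coord.subtype_mk _⟩

lemma normalize_toPunctured (A : SU2) : normalize (toPunctured A) = A := by
  refine coord_injective ((coord_ofCoord _ (lenSq_normalize (coord_ne_zero A))).trans ?_)
  rw [lenSq_coord]
  simp

lemma segment_smul_ne_zero {E : Type} [AddCommGroup E] [Module ℝ E] {v : E} (hv : v ≠ 0) {r s : ℝ}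
    (hr : 0 < r) (h0 : 0 ≤ s) (h1 : s ≤ 1) : (1 - s) • v + s • r • v ≠ 0 := by
  rw [smul_smul, ← add_smul]
  refine smul_ne_zero (ne_of_gt ?_) hv
  rcases h0.eq_or_lt with rfl | h0
  · simp
  · have := mul_pos h0 hr
    linarith

lemma toPunctured_normalize :
    (toPunctured.comp normalize).Homotopic (ContinuousMap.id Homology.Punctured4) := by
  refine ContinuousMap.Homotopic.symm (Homology.homotopic_of_segment
    (ι := fun q : Homology.Punctured4 => (((), q.1) : Unit × QuatCoord)) ?_ _ _ (fun _ => rfl)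
    fun q s h0 h1 => ?_)
  · exact (Homeomorph.punitProd QuatCoord).symm.isEmbedding.comp
      Topology.IsEmbedding.subtypeVal
  · refine ⟨⟨_, ?_⟩, rfl⟩
    have h : (toPunctured (normalize q)).1 = (√(lenSq q.1))⁻¹ • q.1 :=
      coord_ofCoord _ (lenSq_normalize q.2)
    change (1 - s) • q.1 + s • (toPunctured (normalize q)).1 ≠ 0
    rw [h]
    exact segment_smul_ne_zero q.2 (inv_pos.2 (Real.sqrt_pos.2 (lenSq_pos q.2))) h0 h1

instance pathConnectedSpace : PathConnectedSpace SU2 :=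
  (show Function.Surjective normalize from
    fun A => ⟨_, normalize_toPunctured A⟩).pathConnectedSpace normalize.continuous

lemma coord_smul_toMatrix {q : QuatCoord} (h : q ≠ 0) :
    ∃ g : SU2, ∃ r : ℝ, r ≠ 0 ∧ q.toMatrix = r • g.1 := by
  have h1 := (Real.sqrt_pos.2 (lenSq_pos h)).ne'
  refine ⟨ofCoord _ (lenSq_normalize h), √(lenSq q), h1, ?_⟩
  have h2 : q = √(lenSq q) • (√(lenSq q))⁻¹ • q := by
    rw [smul_smul, mul_inv_cancel₀ h1, one_smul]
  exact (congrArg toMatrix h2).trans (toMatrix_smul _ _)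

lemma trace_eq (A : SU2) :
    A.1 + (A⁻¹).1 = (2 * (coord A).2 : ℂ) • (1 : Matrix (Fin 2) (Fin 2) ℂ) := by
  have h1 : (A⁻¹).1 = star A.1 := rfl
  rw [h1, ← toMatrix_coord]
  ext i j
  fin_cases i <;> fin_cases j <;>
    simp [toMatrix, Matrix.star_apply, Complex.ext_iff] <;> ring

/-- Elements of `SU2` with the same trace are conjugate. -/
lemma isConj_of_coord_eq {A B : SU2} (hA : ∃ X, A * X ≠ X * A) (h : (coord A).2 = (coord B).2) :
    ∃ g : SU2, g * A * g⁻¹ = B := by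
  -- Otherwise $X=1$ gives $B=A^{-1}$, and then $A$ would be central.
  obtain ⟨X, hX⟩ : ∃ X : SU2, B * X ≠ X * A⁻¹ := by
    by_contra! hX
    obtain ⟨X, hX'⟩ := hA
    have h1 : B = A⁻¹ := by simpa using hX 1
    have h2 := hX X
    rw [h1, inv_mul_eq_iff_eq_mul, ← mul_assoc, eq_mul_inv_iff_mul_eq] at h2
    exact hX' h2.symm
  -- The quaternion $Q=BX-XA^{-1}$ intertwines: $QA=BQ$, because $A+A^{-1}$ and $B+B^{-1}$ are the
  -- same real scalar. Being nonzero, $Q$ is a real multiple of an element of SU(2), which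
  -- conjugates $A$ to $B$.
  have hQ : coord (B * X) - coord (X * A⁻¹) ≠ 0 := fun h' =>
    hX (coord_injective (sub_eq_zero.1 h'))
  obtain ⟨g, r, hr, hg⟩ := coord_smul_toMatrix hQ
  rw [toMatrix_sub, toMatrix_coord, toMatrix_coord] at hg
  refine ⟨g, mul_inv_eq_iff_eq_mul.2 (Subtype.ext (smul_right_injective _ hr ?_))⟩
  have hA := trace_eq A
  have hB := trace_eq B
  rw [← h] at hB
  have hB' : B.1 * B.1 = (2 * (coord A).2 : ℂ) • B.1 - 1 := by
    have h1 : B.1 * (B⁻¹).1 = 1 := congrArg Subtype.val (mul_inv_cancel B)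
    have h2 := congrArg (B.1 * ·) hB
    simp only [mul_add, h1, mul_smul_comm, mul_one] at h2
    rw [← h2, add_sub_cancel_right]
  have hA' : A.1 = (2 * (coord A).2 : ℂ) • 1 - (A⁻¹).1 := by rw [← hA, add_sub_cancel_right]
  have hA2 : (A⁻¹).1 * A.1 = 1 := congrArg Subtype.val (inv_mul_cancel A)
  change r • (g.1 * A.1) = r • (B.1 * g.1)
  rw [← smul_mul_assoc, ← mul_smul_comm, ← hg]
  change (B.1 * X.1 - X.1 * (A⁻¹).1) * A.1 = B.1 * (B.1 * X.1 - X.1 * (A⁻¹).1)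
  rw [sub_mul, mul_assoc X.1, hA2, mul_sub, ← mul_assoc B.1 B.1, hB', mul_one]
  nth_rw 1 [hA']
  simp only [mul_sub, sub_mul, mul_smul_comm, smul_mul_assoc, mul_one, one_mul, mul_assoc]
  abel

lemma coord_conj (g A : SU2) : (coord (g * A * g⁻¹)).2 = (coord A).2 := by
  have h1 := trace_eq (g * A * g⁻¹)
  have h2 := trace_eq A
  have h3 : (g * A * g⁻¹).1 + ((g * A * g⁻¹)⁻¹).1 = g.1 * (A.1 + (A⁻¹).1) * (g⁻¹).1 := by
    rw [mul_add, add_mul, conj_inv]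
    rfl
  have h4 : g.1 * (g⁻¹).1 = 1 := congrArg Subtype.val (mul_inv_cancel g)
  rw [h3, h2, mul_smul_comm, mul_one, smul_mul_assoc, h4] at h1
  have h5 := congrFun₂ h1 0 0
  simpa using h5.symm

lemma imSq_pos_of_not_central {A : SU2} (hA : ∃ X, A * X ≠ X * A) : (coord A).1 ≠ 0 := by
  rintro h
  obtain ⟨X, hX⟩ := hA
  have h1 : A.1 = ((coord A).2 : ℂ) • (1 : Matrix (Fin 2) (Fin 2) ℂ) := by
    rw [← toMatrix_coord]
    ext i j
    fin_cases i <;> fin_cases j <;>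
      simp [toMatrix, Complex.ext_iff, h]
  refine hX (Subtype.ext ?_)
  change A.1 * X.1 = X.1 * A.1
  rw [h1, smul_mul_assoc, mul_smul_comm, one_mul, mul_one]

end SU2

/-! ### Fundamental classes as generators -/

namespace Homology

variable {X Y : Type} [TopologicalSpace X] [TopologicalSpace Y] {n : ℕ}

/-- Additive equivalences of homology groups are linear. -/
def linearEquivOfAddEquiv {M N : Type} [AddCommGroup M] [AddCommGroup N] [Module ℤ M] [Module ℤ N]
    (e : M ≃+ N) : M ≃ₗ[ℤ] N :=
  { e with map_smul' := fun c z => by simpa using map_intCast_smul e ℤ ℤ c z }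

lemma _root_.IsFundamentalClass.map_of_bijective {c : Homology n X} (hc : IsFundamentalClass n c)
    {f : C(X, Y)} (hf : Function.Bijective (map n f)) : IsFundamentalClass n (map n f c) := by
  have h : (fun k : ℤ => k • map n f c) = map n f ∘ fun k : ℤ => k • c :=
    funext fun k => (map_zsmul (map n f) k c).symm
  rw [IsFundamentalClass, h]
  exact hf.comp hc

lemma _root_.IsFundamentalClass.eq_one_or_neg_one {c : Homology n X} (hc : IsFundamentalClass n c)
    (φ : Homology n X ≃ₗ[ℤ] ℤ) : φ c = 1 ∨ φ c = -1 := by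
  -- Some multiple of `φ c` equals 1, so `φ c` is a unit of $\mathbb Z$.
  obtain ⟨k, hk⟩ := hc.2 (φ.symm 1)
  have h1 := congrArg φ hk
  simp only [map_zsmul, LinearEquiv.apply_symm_apply, smul_eq_mul] at h1
  exact Int.isUnit_iff.1 (IsUnit.of_mul_eq_one_right _ h1)

lemma exists_isFundamentalClass (φ : Homology n X ≃+ ℤ) :
    ∃ c : Homology n X, IsFundamentalClass n c := by
  refine ⟨φ.symm 1, ?_⟩
  have h : (fun k : ℤ => k • φ.symm 1) = φ.symm :=
    funext fun k => by rw [← map_zsmul, smul_eq_mul, mul_one]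
  rw [IsFundamentalClass, h]
  exact φ.symm.bijective

end Homology

/-! ### Homology of SU(2) and its square; inversion and translations -/

namespace SU2

open Homology

/-- The homology of `SU2`. -/
noncomputable def homologyEquiv (n : ℕ) : Homology n SU2 ≃ₗ[ℤ] Homology n Punctured4 :=
  equivOfHomotopic toPunctured normalize
    (by
      rw [show normalize.comp toPunctured = ContinuousMap.id SU2 from
        ContinuousMap.ext normalize_toPunctured])
    toPunctured_normalize n

/-- The third homology of `SU2`. -/
noncomputable def homologyThreeEquiv : Homology 3 SU2 ≃ₗ[ℤ] ℤ :=
  linearEquivOfAddEquiv ((homologyEquiv 3).toAddEquiv.trans punctured4Equiv)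

lemma map_prodMap_toPunctured_bijective (n : ℕ) (X : Type) [TopologicalSpace X] :
    Function.Bijective (map n ((ContinuousMap.id X).prodMap toPunctured)) := by
  refine map_bijective_of_homotopic _ ((ContinuousMap.id X).prodMap normalize) ?_ ?_ n
  · rw [show ((ContinuousMap.id X).prodMap normalize).comp ((ContinuousMap.id X).prodMap
      toPunctured) = ContinuousMap.id (X × SU2) from
        ContinuousMap.ext fun q => Prod.ext rfl (normalize_toPunctured q.2)]
  · exact ContinuousMap.Homotopic.prodMap (.refl (ContinuousMap.id X)) toPunctured_normalize

/-- The base contributes $H_5(S^3)=0$ and the fiber kernel is $H_2(S^3)=0$. -/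
lemma subsingleton_homology_five : Subsingleton (Homology 5 (SU2 × SU2)) := by
  have h5 := subsingleton_punctured4_five
  have h2 := subsingleton_punctured4_two
  have h2' := (homologyEquiv 2).injective.subsingleton
  exact @Function.Injective.subsingleton _ _ _ (map_prodMap_toPunctured_bijective 5 SU2).1
    (subsingleton_prod (homologyEquiv 5).injective.subsingleton
      (fibreKer4Equiv 2 SU2).injective.subsingleton)

/-- The degree 3 part of Künneth: on the kernel of the first projection, collapsing the base to a
point is injective because $H_0(\mathrm{SU}(2))\to H_0(\mathrm{pt})$ is, and the collapse is the
second projection. -/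
lemma eq_zero_of_map_fst_of_map_snd {z : Homology 3 (SU2 × SU2)}
    (h1 : map 3 ContinuousMap.fst z = 0) (h2 : map 3 ContinuousMap.snd z = 0) : z = 0 := by
  refine (map_eq_zero_iff _ (map_prodMap_toPunctured_bijective 3 SU2).1).1 ?_
  refine map_prodMapLeft_injective (map_zero_injective (ContinuousMap.const SU2 ())) ?_ ?_
  · rw [LinearMap.mem_ker, map_map]
    exact h1
  · refine (map_eq_zero_iff _ (equivOfHomeomorph 3 (Homeomorph.punitProd Punctured4)).injective).1 ?_
    change map 3 _ _ = 0
    rw [map_map, map_map]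
    have h3 : ((Homeomorph.punitProd Punctured4 : C(PUnit × Punctured4, Punctured4)).comp
        (prodMapLeft Punctured4 (ContinuousMap.const SU2 ()))).comp
          ((ContinuousMap.id SU2).prodMap toPunctured) = toPunctured.comp ContinuousMap.snd := rfl
    exact (congrArg (fun f => map 3 f z) h3).trans (by rw [← map_map, h2, map_zero])

lemma eq_of_map_fst_of_map_snd {z w : Homology 3 (SU2 × SU2)}
    (h1 : map 3 ContinuousMap.fst z = map 3 ContinuousMap.fst w)
    (h2 : map 3 ContinuousMap.snd z = map 3 ContinuousMap.snd w) : z = w := by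
  refine sub_eq_zero.1 (eq_zero_of_map_fst_of_map_snd ?_ ?_)
  · rw [map_sub, h1, sub_self]
  · rw [map_sub, h2, sub_self]

/-- The inversion of `SU2`. -/
def inv : C(SU2, SU2) := ⟨fun A => A⁻¹, continuous_subtype_val.star.subtype_mk _⟩

/-- The multiplication of `SU2`. -/
def mul : C(SU2 × SU2, SU2) := ⟨fun q => q.1 * q.2, continuous_mul⟩

/-- The two projections show that $a\mapsto(a,a^{-1})$ induces the sum of the maps $a\mapsto(a,1)$
and $a\mapsto(1,a^{-1})$. Multiplying components turns this into $0=z+\mathrm{inv}_*z$. -/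
lemma map_inv (z : Homology 3 SU2) : map 3 inv z = -z := by
  have h : map 3 ((ContinuousMap.id SU2).prodMk inv) z =
      map 3 ((ContinuousMap.id SU2).prodMk (ContinuousMap.const SU2 1)) z +
        map 3 ((ContinuousMap.const SU2 1).prodMk (ContinuousMap.id SU2)) (map 3 inv z) := by
    apply eq_of_map_fst_of_map_snd
    · rw [map_add, map_map, map_map, map_map]
      exact (add_eq_left.2 (map_const three_ne_zero 1 _)).symm
    · rw [map_add, map_map, map_map, map_map]
      exact ((add_eq_right.2 (map_const three_ne_zero 1 _)).trans (map_id _)).symm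
  have h1 := congrArg (map 3 mul) h
  rw [map_add, map_map, map_map, map_map] at h1
  have h2 : mul.comp ((ContinuousMap.id SU2).prodMk inv) = ContinuousMap.const SU2 1 :=
    ContinuousMap.ext fun A => mul_inv_cancel A
  have h3 : mul.comp ((ContinuousMap.id SU2).prodMk (ContinuousMap.const SU2 1)) =
    ContinuousMap.id SU2 := ContinuousMap.ext fun A => mul_one A
  have h4 : mul.comp ((ContinuousMap.const SU2 1).prodMk (ContinuousMap.id SU2)) =
    ContinuousMap.id SU2 := ContinuousMap.ext fun A => one_mul A
  rw [h2, h3, h4, map_id, map_id, map_const three_ne_zero] at h1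
  exact (neg_eq_of_add_eq_zero_right h1.symm).symm

/-- Right translation on `SU2`. -/
def mulRight (B : SU2) : C(SU2, SU2) := ⟨fun A => A * B, continuous_mul_const B⟩

lemma map_mulRight {n : ℕ} (B : SU2) (z : Homology n SU2) : map n (mulRight B) z = z := by
  have h : (slice SU2 B).Homotopic (slice SU2 1) :=
    slice_homotopic (PathConnectedSpace.joined _ _)
  have h1 : mulRight B = mul.comp (slice SU2 B) := rfl
  have h2 : mul.comp (slice SU2 1) = ContinuousMap.id SU2 := ContinuousMap.ext fun A => mul_one A
  rw [h1, ← map_map, map_eq_of_homotopic h, map_map, h2, map_id]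

end SU2

/-! ### Twisted classes: description, section, and the central case -/

namespace SU2

open Homology

lemma mem_twistedClass_iff {G : Type*} [Group G] {p q : G × G} :
    q ∈ twistedClass p ↔ ∃ g : G, g * (p.1 * p.2) * g⁻¹ = q.1 * q.2 := by
  constructor
  · rintro ⟨g, rfl⟩
    exact ⟨g.1, by simp only [twistedAd]; group⟩
  · rintro ⟨g, h⟩
    -- The second entry is forced by $g\,p_1z^{-1}=q_1$; the equation for the other component is
    -- then the conjugacy.
    refine ⟨(g, q.1⁻¹ * g * p.1), Prod.ext (by simp only [twistedAd]; group) ?_⟩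
    simp only [twistedAd]
    rw [mul_assoc q.1⁻¹, mul_assoc q.1⁻¹, mul_assoc q.1⁻¹, mul_assoc g, h, inv_mul_cancel_left]

variable {p : SU2 × SU2}

/-- The first projection of a twisted conjugacy class. -/
noncomputable def classFst (p : SU2 × SU2) : C(twistedClass p, SU2) :=
  ContinuousMap.fst.comp (incl (twistedClass p))

/-- A section of the first projection of a twisted conjugacy class. -/
noncomputable def classSection (p : SU2 × SU2) : C(SU2, twistedClass p) :=
  ⟨fun A => ⟨(A, A⁻¹ * (p.1 * p.2)), mem_twistedClass_iff.2 ⟨1, by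
    rw [one_mul, inv_one, mul_one, mul_inv_cancel_left]⟩⟩,
    (continuous_id.prodMk ((mulRight (p.1 * p.2)).comp inv).continuous).subtype_mk _⟩

lemma classFst_comp_classSection :
    (classFst p).comp (classSection p) = ContinuousMap.id SU2 := rfl

section Central

variable (hp : ∀ X, p.1 * p.2 * X = X * (p.1 * p.2))

include hp in
lemma mul_eq_of_central (q : twistedClass p) : q.1.1 * q.1.2 = p.1 * p.2 := by
  obtain ⟨g, hg⟩ := mem_twistedClass_iff.1 q.2
  rw [← hg, ← hp, mul_inv_cancel_right]

include hp in
lemma classSection_comp_classFst :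
    (classSection p).comp (classFst p) = ContinuousMap.id (twistedClass p) := by
  refine ContinuousMap.ext fun q => Subtype.ext (Prod.ext rfl ?_)
  change q.1.1⁻¹ * (p.1 * p.2) = q.1.2
  rw [← mul_eq_of_central hp q, inv_mul_cancel_left]

include hp in
lemma map_classFst_bijective (n : ℕ) : Function.Bijective (map n (classFst p)) :=
  map_bijective_of_homotopic _ (classSection p) (by rw [classSection_comp_classFst hp])
    (by rw [classFst_comp_classSection]) n

include hp in
lemma map_snd_class (c : Homology 3 (twistedClass p)) :
    map 3 ContinuousMap.snd (map 3 (incl (twistedClass p)) c) = -map 3 (classFst p) c := by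
  have h : ContinuousMap.snd.comp (incl (twistedClass p)) =
      (mulRight (p.1 * p.2)).comp (inv.comp (classFst p)) := by
    refine ContinuousMap.ext fun q => ?_
    change q.1.2 = q.1.1⁻¹ * (p.1 * p.2)
    rw [← mul_eq_of_central hp q, inv_mul_cancel_left]
  rw [map_map, h, ← map_map, map_mulRight, ← map_map, map_inv]

end Central

/-- By the section, the identity of SU(2) factors through the inclusion, and a constant map would
kill $H_3(\mathrm{SU}(2))\cong\mathbb Z$. -/
lemma not_nullhomotopic (p : SU2 × SU2) : ¬ (incl (twistedClass p)).Nullhomotopic := by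
  rintro ⟨y, hy⟩
  have h : ∀ z : Homology 3 SU2, z = 0 := fun z => by
    rw [← map_id z, ← classFst_comp_classSection (p := p), ← map_map, classFst, ← map_map,
      map_eq_of_homotopic hy, map_const three_ne_zero, map_zero]
  have h1 := h (homologyThreeEquiv.symm 1)
  rw [LinearEquiv.map_eq_zero_iff] at h1
  exact one_ne_zero h1

end SU2

/-! ### The non-central case: a product with a 2-sphere up to homotopy -/

namespace SU2

open Homology QuatCoord

section NonCentral

variable {p : SU2 × SU2} (hp : ∃ X, p.1 * p.2 * X ≠ X * (p.1 * p.2))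

/-- The imaginary radius of the products of the two components of a class. -/
noncomputable def classRadius (p : SU2 × SU2) : ℝ := √(imSq (coord (p.1 * p.2)).1)

include hp in
lemma classRadius_pos : 0 < classRadius p :=
  Real.sqrt_pos.2 (imSq_pos (imSq_pos_of_not_central hp))

lemma classRadius_sq : classRadius p ^ 2 + (coord (p.1 * p.2)).2 ^ 2 = 1 := by
  have h : 0 ≤ imSq (coord (p.1 * p.2)).1 := by
    unfold imSq
    positivity
  rw [classRadius, Real.sq_sqrt h]
  exact lenSq_coord _

lemma coord_mul_snd (q : twistedClass p) : (coord (q.1.1 * q.1.2)).2 = (coord (p.1 * p.2)).2 := by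
  obtain ⟨g, hg⟩ := mem_twistedClass_iff.1 q.2
  rw [← hg, coord_conj]

lemma imSq_coord_mul (q : twistedClass p) : imSq (coord (q.1.1 * q.1.2)).1 = classRadius p ^ 2 := by
  have h1 := lenSq_coord (q.1.1 * q.1.2)
  have h2 := classRadius_sq (p := p)
  rw [lenSq, coord_mul_snd] at h1
  linarith

lemma continuous_coord_mul :
    Continuous fun q : twistedClass p => coord (q.1.1 * q.1.2) :=
  continuous_coord.comp (mul.continuous.comp continuous_subtype_val)

/-- The first component and the imaginary part of the product of the components. -/
noncomputable def classIm : C(twistedClass p, SU2 × Punctured3) :=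
  ⟨fun q => (q.1.1, ⟨(coord (q.1.1 * q.1.2)).1, fun h => by
      have h1 := imSq_coord_mul q
      rw [h] at h1
      have h2 := pow_pos (classRadius_pos hp) 2
      simp [imSq, ← h1] at h2⟩),
    (continuous_fst.comp continuous_subtype_val).prodMk
      ((continuous_fst.comp continuous_coord_mul).subtype_mk _)⟩

/-- The coordinates of the quaternion with a given direction and the trace of the class. -/
noncomputable def classCoord (p : SU2 × SU2) (v : Punctured3) : QuatCoord :=
  ((classRadius p / √(imSq v.1)) • v.1, (coord (p.1 * p.2)).2)

lemma lenSq_classCoord (v : Punctured3) : lenSq (classCoord p v) = 1 := by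
  have h := imSq_pos v.2
  rw [lenSq, classCoord, imSq_smul, div_pow, Real.sq_sqrt h.le, div_mul_cancel₀ _ h.ne']
  exact classRadius_sq

lemma continuous_classCoord : Continuous (classCoord p) := by
  have h := continuous_imSq.comp (continuous_subtype_val (p := fun v : (ℝ × ℝ) × ℝ => v ≠ 0))
  exact ((continuous_const.div h.sqrt fun v => (Real.sqrt_pos.2 (imSq_pos v.2)).ne').smul
    continuous_subtype_val).prodMk continuous_const

/-- The element of `SU2` with a given direction and the trace of the class. -/
noncomputable def classPoint (p : SU2 × SU2) : C(Punctured3, SU2) :=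
  ⟨fun v => ofCoord (classCoord p v) (lenSq_classCoord v),
    (continuous_toMatrix.comp continuous_classCoord).subtype_mk _⟩

lemma coord_classPoint (v : Punctured3) : coord (classPoint p v) = classCoord p v :=
  coord_ofCoord _ (lenSq_classCoord v)

/-- The point of the class with given first component and direction. -/
noncomputable def classOfIm : C(SU2 × Punctured3, twistedClass p) :=
  ⟨fun q => ⟨(q.1, q.1⁻¹ * classPoint p q.2), mem_twistedClass_iff.2 (by
      rw [mul_inv_cancel_left]
      refine isConj_of_coord_eq hp ?_
      rw [coord_classPoint]
      rfl)⟩,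
    (continuous_fst.prodMk (mul.continuous.comp ((inv.continuous.comp continuous_fst).prodMk
      ((classPoint p).continuous.comp continuous_snd)))).subtype_mk _⟩

lemma classOfIm_comp_classIm :
    (classOfIm hp).comp (classIm hp) = ContinuousMap.id (twistedClass p) := by
  refine ContinuousMap.ext fun q => Subtype.ext (Prod.ext rfl ?_)
  change q.1.1⁻¹ * classPoint p (classIm hp q).2 = q.1.2
  rw [inv_mul_eq_iff_eq_mul]
  refine coord_injective ?_
  have h : (classIm hp q).2.1 = (coord (q.1.1 * q.1.2)).1 := rfl
  rw [coord_classPoint, classCoord, h, imSq_coord_mul, Real.sqrt_sq (classRadius_pos hp).le,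
    div_self (classRadius_pos hp).ne', one_smul, ← coord_mul_snd q]

lemma classIm_comp_classOfIm :
    ((classIm hp).comp (classOfIm hp)).Homotopic (ContinuousMap.id (SU2 × Punctured3)) := by
  refine ContinuousMap.Homotopic.symm (homotopic_of_segment
    (ι := fun q : SU2 × Punctured3 => ((q.1, q.2.1) : SU2 × ((ℝ × ℝ) × ℝ)))
    (Topology.IsEmbedding.id.prodMap Topology.IsEmbedding.subtypeVal) _ _ (fun _ => rfl)
    fun q s h0 h1 => ?_)
  have h : (classIm hp (classOfIm hp q)).2.1 = (classRadius p / √(imSq q.2.1)) • q.2.1 := by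
    change (coord (q.1 * (q.1⁻¹ * classPoint p q.2))).1 = _
    rw [mul_inv_cancel_left, coord_classPoint]
    rfl
  refine ⟨(q.1, ⟨(1 - s) • q.2.1 + s • (classIm hp (classOfIm hp q)).2.1, ?_⟩), rfl⟩
  rw [h]
  exact segment_smul_ne_zero q.2.2
    (div_pos (classRadius_pos hp) (Real.sqrt_pos.2 (imSq_pos q.2.2))) h0 h1

/-- The top homology of a class of non-central type. -/
noncomputable def classHomologyFiveEquiv : Homology 5 (twistedClass p) ≃+ ℤ :=
  -- Since $H_5(\mathrm{SU}(2))=0$, the fiber kernel is all of $H_5$; removing $\mathbb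
  -- R^3\setminus0$ lowers the degree by two, to $H_3(\mathrm{SU}(2))$.
  have := subsingleton_punctured4_five
  ((equivOfHomotopic (classIm hp) (classOfIm hp) (by rw [classOfIm_comp_classIm])
    (classIm_comp_classOfIm hp) 5).toAddEquiv.trans
      (fibreKerEquiv SU2 Punctured3 (homologyEquiv 5).injective.subsingleton)).trans
    ((fibreKer3Equiv 3 SU2).trans homologyThreeEquiv.toAddEquiv)

end NonCentral

end SU2

/-! ### Tangent spaces of embedded submanifolds -/

namespace IsSmoothSubmanifold

variable {V : Type*} [NormedAddCommGroup V] [NormedSpace ℝ V] [FiniteDimensional ℝ V] {d : ℕ}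
  {S : Set V}

/-- The difference quotients lie in `L`, which is closed in finite dimension. -/
lemma mem_of_hasDerivAt {L : Submodule ℝ V} {γ : ℝ → V} {v : V} (h : HasDerivAt γ v 0)
    (hγ : ∀ᶠ s in nhds 0, γ s ∈ L) : v ∈ L := by
  have hc : IsClosed (L : Set V) := L.closed_of_finiteDimensional
  refine hc.mem_of_tendsto h.tendsto_slope ?_
  filter_upwards [hγ.filter_mono nhdsWithin_le_nhds] with s hs
  rw [slope_def_module]
  exact L.smul_mem _ (L.sub_mem hs hγ.self_of_nhds)

/-- The tangent space of a submanifold. -/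
lemma exists_tangent (h : IsSmoothSubmanifold d S) {p : V} (hp : p ∈ S) :
    ∃ T : Submodule ℝ V, Module.finrank ℝ T = d ∧
      (∀ (γ : ℝ → V) (v : V), HasDerivAt γ v 0 → γ 0 = p → (∀ s, γ s ∈ S) → v ∈ T) ∧
      ∀ W : Submodule ℝ V, S ⊆ W → T ≤ W := by
  obtain ⟨e, L, hpe, he, he', hL, hS⟩ := h p hp
  have hpt : e p ∈ e.target := e.map_source hpe
  have hd : DifferentiableAt ℝ e p :=
    (he.contDiffAt (e.open_source.mem_nhds hpe)).differentiableAt (by simp)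
  have hd' : DifferentiableAt ℝ e.symm (e p) :=
    (he'.contDiffAt (e.open_target.mem_nhds hpt)).differentiableAt (by simp)
  have h1 := hd.hasFDerivAt
  have h2 := hd'.hasFDerivAt
  have h21 : ∀ v, fderiv ℝ e.symm (e p) (fderiv ℝ e p v) = v := by
    have h3 : HasFDerivAt (e.symm ∘ e) (ContinuousLinearMap.id ℝ V) p :=
      (hasFDerivAt_id p).congr_of_eventuallyEq (e.eventually_left_inverse hpe)
    exact fun v => congrArg (· v) ((h2.comp p h1).unique h3)
  have h12 : ∀ v, fderiv ℝ e p (fderiv ℝ e.symm (e p) v) = v := by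
    have h3 : HasFDerivAt (e ∘ e.symm) (ContinuousLinearMap.id ℝ V) (e p) :=
      (hasFDerivAt_id _).congr_of_eventuallyEq (e.eventually_right_inverse hpt)
    have h1' : HasFDerivAt e (fderiv ℝ e p) (e.symm (e p)) := by rwa [e.left_inv hpe]
    exact fun v => congrArg (· v) ((h1'.comp (e p) h2).unique h3)
  -- The tangent space is the image of the model subspace under the derivative of the inverse chart.
  refine ⟨L.map (fderiv ℝ e.symm (e p)).toLinearMap, ?_, fun γ v hγ h0 hγS => ?_, fun W hW => ?_⟩
  · rw [← hL]
    exact (LinearEquiv.finrank_eq (Submodule.equivMapOfInjective _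
      (Function.LeftInverse.injective h12) L)).symm
  · refine ⟨fderiv ℝ e p v, mem_of_hasDerivAt (γ := e ∘ γ) ?_ ?_, h21 v⟩
    · subst h0
      exact h1.comp_hasDerivAt 0 hγ
    · have hc : ∀ᶠ s in nhds 0, γ s ∈ e.source :=
        hγ.continuousAt.eventually_mem (e.open_source.mem_nhds (by rwa [h0]))
      filter_upwards [hc] with s hs
      exact (hS _ hs).1 (hγS s)
  · rintro _ ⟨l, hl, rfl⟩
    have hpL : e p ∈ L := (hS p hpe).1 hp
    -- The inverse chart carries this line, near 0, into `S ⊆ W`, so its velocity there lies in `W`.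
    have hline : HasDerivAt (fun s : ℝ => e p + s • l) l 0 := by
      simpa using ((hasDerivAt_id (0 : ℝ)).smul_const l).const_add (e p)
    have h2' : HasFDerivAt e.symm (fderiv ℝ e.symm (e p)) (e p + (0 : ℝ) • l) := by
      simpa using h2
    refine mem_of_hasDerivAt (h2'.comp_hasDerivAt 0 hline) ?_
    have hc : ∀ᶠ s : ℝ in nhds 0, e p + s • l ∈ e.target :=
      hline.continuousAt.eventually_mem (e.open_target.mem_nhds (by simpa using hpt))
    filter_upwards [hc] with s hs
    refine hW ((hS _ (e.map_target hs)).2 ?_)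
    rw [e.right_inv hs]
    exact L.add_mem hpL (L.smul_mem s hl)

end IsSmoothSubmanifold

/-! ### Dimension bounds that separate the two cases -/

namespace SU2

open QuatCoord

/-- The real vector space of `2 × 2` arrays. -/
abbrev Array2 : Type := Fin 2 → Fin 2 → ℂ

/-- A matrix as an array. -/
noncomputable def toArray : Matrix (Fin 2) (Fin 2) ℂ →ₗ[ℝ] Array2 := (Matrix.ofLinearEquiv ℝ).symm.toLinearMap

lemma toArray_injective : Function.Injective toArray := (Matrix.ofLinearEquiv ℝ).symm.injective

lemma su2ProdEmb_eq (q : SU2 × SU2) : su2ProdEmb q = (toArray q.1.1, toArray q.2.1) := rfl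

/-- The complex matrix of a quaternion, as a linear map. -/
def toMatrixₗ : QuatCoord →ₗ[ℝ] Matrix (Fin 2) (Fin 2) ℂ where
  toFun := toMatrix
  map_add' := toMatrix_add
  map_smul' := toMatrix_smul

/-- The complex matrix of an imaginary quaternion. -/
noncomputable def imMatrix : (ℝ × ℝ) × ℝ →ₗ[ℝ] Matrix (Fin 2) (Fin 2) ℂ := toMatrixₗ ∘ₗ LinearMap.inl ℝ _ _

variable {p : SU2 × SU2}

/-- On SU(2) inversion is the adjoint, which is real linear. So the graph of $a\mapsto a^{-1}c$ lies
in the linear image of the quaternions under $q\mapsto(q,q^*c)$. -/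
lemma dim_le_of_central (hp : ∀ X, p.1 * p.2 * X = X * (p.1 * p.2)) {d : ℕ}
    (h : HasDim d (twistedClass p)) : d ≤ 4 := by
  obtain ⟨T, hT, -, hW⟩ := h.exists_tangent ⟨_, (classSection p 1).2, rfl⟩
  let F : QuatCoord →ₗ[ℝ] Array2 × Array2 :=
    (toArray ∘ₗ toMatrixₗ).prod (toArray ∘ₗ LinearMap.mulRight ℝ (p.1 * p.2).1 ∘ₗ
      (starLinearEquiv ℝ (A := Matrix (Fin 2) (Fin 2) ℂ)).toLinearMap ∘ₗ toMatrixₗ)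
  have h1 : T ≤ LinearMap.range F := by
    refine hW _ ?_
    rintro _ ⟨q, hq, rfl⟩
    refine ⟨coord q.1, ?_⟩
    have h2 : q.2 = q.1⁻¹ * (p.1 * p.2) := by
      rw [← mul_eq_of_central hp ⟨q, hq⟩, inv_mul_cancel_left]
    have h3 : toMatrixₗ (coord q.1) = q.1.1 := toMatrix_coord q.1
    rw [su2ProdEmb_eq, h2]
    exact Prod.ext (congrArg toArray h3)
      (congrArg (fun A => toArray (star A * (p.1 * p.2).1)) h3)
  rw [← hT]
  refine (Submodule.finrank_mono h1).trans ((LinearMap.finrank_range_le F).trans ?_)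
  simp

/-- The one-parameter group generated by an imaginary unit quaternion. -/
noncomputable def rot (B : SU2) (hB : (coord B).2 = 0) (s : ℝ) : SU2 :=
  ofCoord (Real.sin s • (coord B).1, Real.cos s) (by
    have h := lenSq_coord B
    rw [lenSq, hB] at h
    rw [lenSq, imSq_smul]
    nlinarith [Real.sin_sq_add_cos_sq s])

lemma coe_rot {B : SU2} (hB : (coord B).2 = 0) (s : ℝ) :
    (rot B hB s).1 = Real.cos s • (1 : Matrix (Fin 2) (Fin 2) ℂ) + Real.sin s • B.1 := by
  rw [← toMatrix_coord B]
  ext i j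
  fin_cases i <;> fin_cases j <;> simp [rot, ofCoord, toMatrix, Complex.ext_iff, hB,
    Complex.cos_ofReal_re, Complex.sin_ofReal_re]

lemma coe_rot_inv {B : SU2} (hB : (coord B).2 = 0) (s : ℝ) :
    ((rot B hB s)⁻¹).1 = Real.cos s • (1 : Matrix (Fin 2) (Fin 2) ℂ) - Real.sin s • B.1 := by
  have h := trace_eq (rot B hB s)
  have h1 : (coord (rot B hB s)).2 = Real.cos s := congrArg Prod.snd (coord_ofCoord _ _)
  rw [coe_rot, h1] at h
  rw [← eq_sub_iff_add_eq'] at h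
  rw [h]
  ext i j
  simp
  ring

lemma hasDerivAt_cos_sin {V : Type*} [NormedAddCommGroup V] [NormedSpace ℝ V] (P Q : V) :
    HasDerivAt (fun s => Real.cos s • P + Real.sin s • Q) Q 0 := by
  simpa using ((Real.hasDerivAt_cos 0).smul_const P).fun_add ((Real.hasDerivAt_sin 0).smul_const Q)

/-- The shape of $(\cos s+B\sin s)\,c\,(\cos s-B\sin s)$, whose derivative at 0 is $Bc-cB$. -/
lemma hasDerivAt_cos_sin_sq {V : Type*} [NormedAddCommGroup V] [NormedSpace ℝ V] (P Q R : V) :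
    HasDerivAt (fun s => (Real.cos s) ^ 2 • P + (Real.cos s * Real.sin s) • Q -
      (Real.sin s) ^ 2 • R) Q 0 := by
  have h1 := Real.hasDerivAt_cos 0
  have h2 := Real.hasDerivAt_sin 0
  simpa using (((h1.fun_pow 2).smul_const P).fun_add ((h1.fun_mul h2).smul_const Q)).fun_sub
    ((h2.fun_pow 2).smul_const R)

lemma exists_imMatrix_eq (v : (ℝ × ℝ) × ℝ) :
    ∃ B : SU2, (coord B).2 = 0 ∧ ∃ r : ℝ, imMatrix v = r • B.1 := by
  by_cases hv : v = 0
  -- Any imaginary unit serves here, since the scalar is 0.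
  · refine ⟨ofCoord (((1, 0), 0), 0) (by norm_num [lenSq, imSq]), ?_, 0, ?_⟩
    · rw [coord_ofCoord]
    · rw [hv, map_zero, zero_smul]
  · have hv' : ((v, 0) : QuatCoord) ≠ 0 := fun h => hv (congrArg Prod.fst h)
    obtain ⟨B, r, hr, h⟩ := coord_smul_toMatrix hv'
    refine ⟨B, ?_, r, h⟩
    rw [← toMatrix_coord B, ← toMatrix_smul] at h
    have h1 := congrArg (fun A => (ofMatrix A).2) h
    simp only [ofMatrix_toMatrix, Prod.smul_snd, smul_eq_mul] at h1
    exact (mul_eq_zero.1 h1.symm).resolve_left hr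

/-- At $(1,c)$ the vectors $(-v,vc)$ with $v$ imaginary give three dimensions. A fourth is
$(0,Xc-cX)$, nonzero for an $X$ not commuting with $c$. -/
lemma le_dim_of_not_central (hp : ∃ X, p.1 * p.2 * X ≠ X * (p.1 * p.2)) {d : ℕ}
    (h : HasDim d (twistedClass p)) : 4 ≤ d := by
  obtain ⟨X, hX⟩ := hp
  obtain ⟨T, hT, hγ, -⟩ := h.exists_tangent ⟨_, (classSection p 1).2, rfl⟩
  set c := p.1 * p.2 with hc
  have hbase : su2ProdEmb (classSection p 1).1 = (toArray 1, toArray c.1) := by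
    change su2ProdEmb (1, 1⁻¹ * c) = _
    rw [inv_one, one_mul]
    rfl
  have h1 : ∀ v, ((-toArray (imMatrix v), toArray (imMatrix v * c.1)) : Array2 × Array2) ∈ T := by
    intro v
    obtain ⟨B, hB, r, hr⟩ := exists_imMatrix_eq v
    have h2 : ((-toArray B.1, toArray (B.1 * c.1)) : Array2 × Array2) ∈ T := by
      -- The curve $(e^{-sB},e^{sB}c)$ keeps the product of the components equal to $c$.
      refine hγ _ _ (hasDerivAt_cos_sin (su2ProdEmb (classSection p 1).1) _) (by simp)
        fun s => ⟨((rot B hB s)⁻¹, rot B hB s * c), mem_twistedClass_iff.2 ⟨1, by simp [hc]⟩, ?_⟩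
      rw [su2ProdEmb_eq, hbase, Submonoid.coe_mul, coe_rot, coe_rot_inv]
      simp [add_mul, sub_eq_add_neg]
    have h3 := T.smul_mem r h2
    rw [hr]
    simpa using h3
  have h2 : ∀ v, ((0, toArray (imMatrix v * c.1 - c.1 * imMatrix v)) : Array2 × Array2) ∈ T := by
    intro v
    obtain ⟨B, hB, r, hr⟩ := exists_imMatrix_eq v
    have h2 : ((0, toArray (B.1 * c.1 - c.1 * B.1)) : Array2 × Array2) ∈ T := by
      -- The curve $(1,e^{sB}ce^{-sB})$ moves the product inside its conjugacy class.
      refine hγ _ _ (hasDerivAt_cos_sin_sq (0, toArray c.1) _ (0, toArray (B.1 * c.1 * B.1))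
        |>.const_add ((toArray 1, 0) : Array2 × Array2)) (by simp [hbase]) fun s => ⟨(1, rot B hB s * c * (rot B hB s)⁻¹), mem_twistedClass_iff.2 ⟨rot B hB s, by
          rw [one_mul]⟩, ?_⟩
      rw [su2ProdEmb_eq, Submonoid.coe_mul, Submonoid.coe_mul, coe_rot, coe_rot_inv]
      refine Prod.ext (by simp) ?_
      simp only [Prod.snd_add, Prod.snd_sub, Prod.smul_snd, ← map_smul, ← map_add, ← map_sub,
        zero_add]
      congr 1
      simp only [add_mul, mul_sub, smul_mul_assoc, mul_smul_comm, one_mul, mul_one, smul_sub]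
      module
    have h3 := T.smul_mem r h2
    rw [hr]
    simpa [smul_sub] using h3
  let F : QuatCoord →ₗ[ℝ] Array2 × Array2 :=
    ((-(toArray ∘ₗ imMatrix)).prod (toArray ∘ₗ LinearMap.mulRight ℝ c.1 ∘ₗ imMatrix)).coprod
      (LinearMap.toSpanSingleton ℝ _ (0, toArray (X.1 * c.1 - c.1 * X.1)))
  have hXc : ((0, toArray (X.1 * c.1 - c.1 * X.1)) : Array2 × Array2) ∈ T := by
    -- The real part of `X` is scalar and drops out of the commutator, so imaginary directions
    -- suffice.
    have h3 : X.1 = imMatrix (coord X).1 + (coord X).2 • 1 := by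
      rw [← toMatrix_coord]
      ext i j
      fin_cases i <;> fin_cases j <;> simp [imMatrix, toMatrixₗ, toMatrix, Complex.ext_iff]
    have h4 : X.1 * c.1 - c.1 * X.1 =
        imMatrix (coord X).1 * c.1 - c.1 * imMatrix (coord X).1 := by
      rw [h3]
      simp [add_mul, mul_add]
    rw [h4]
    exact h2 _
  have hF : ∀ q, F q ∈ T := fun q => T.add_mem (h1 q.1) (T.smul_mem q.2 hXc)
  have hinj : Function.Injective F := by
    rw [← LinearMap.ker_eq_bot, LinearMap.ker_eq_bot']
    rintro ⟨v, t⟩ hq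
    have h3 : -toArray (imMatrix v) + t • (0 : Array2) = 0 := congrArg Prod.fst hq
    rw [smul_zero, add_zero, neg_eq_zero, map_eq_zero_iff _ toArray_injective] at h3
    have h4 : v = 0 := by
      have h5 := congrArg (fun A => (ofMatrix A).1) h3
      exact (congrArg Prod.fst (ofMatrix_toMatrix (v, 0))).symm.trans (h5.trans rfl)
    subst h4
    have h5 : toArray (imMatrix 0 * c.1) + t • toArray (X.1 * c.1 - c.1 * X.1) = 0 :=
      congrArg Prod.snd hq
    rw [map_zero, zero_mul, map_zero, zero_add, smul_eq_zero, map_eq_zero_iff _ toArray_injective,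
      sub_eq_zero] at h5
    rcases h5 with rfl | h5
    · rfl
    · exact absurd (Subtype.ext h5.symm) hX
  have h3 := LinearMap.finrank_le_finrank_of_injective (f := F.codRestrict T hF)
    (fun a b hab => hinj (congrArg Subtype.val hab))
  rw [hT] at h3
  simpa using h3

end SU2

/-! ### Assembly of the theorem -/

theorem mainTheorem6 :
    Nonempty (Homology 3 SU2 ≃ₗ[ℤ] ℤ) ∧
    (∀ p : SU2 × SU2, HasDim 3 (twistedClass p) →
      (∃ c : Homology 3 (twistedClass p), IsFundamentalClass 3 c) ∧
      ∀ c : Homology 3 (twistedClass p), IsFundamentalClass 3 c →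
        Homology.map 3 (incl (twistedClass p)) c ≠ 0 ∧
        ∀ φ : Homology 3 SU2 ≃ₗ[ℤ] ℤ,
          (φ (Homology.map 3 ContinuousMap.fst (Homology.map 3 (incl (twistedClass p)) c)) = 1 ∧
            φ (Homology.map 3 ContinuousMap.snd
              (Homology.map 3 (incl (twistedClass p)) c)) = -1) ∨
          (φ (Homology.map 3 ContinuousMap.fst (Homology.map 3 (incl (twistedClass p)) c)) = -1 ∧
            φ (Homology.map 3 ContinuousMap.snd
              (Homology.map 3 (incl (twistedClass p)) c)) = 1)) ∧
    Subsingleton (Homology 5 (SU2 × SU2)) ∧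
    (∀ p : SU2 × SU2, HasDim 5 (twistedClass p) →
      (∃ c : Homology 5 (twistedClass p), IsFundamentalClass 5 c) ∧
      (∀ c : Homology 5 (twistedClass p), IsFundamentalClass 5 c →
        Homology.map 5 (incl (twistedClass p)) c = 0) ∧
      ¬ (incl (twistedClass p)).Nullhomotopic) := by
  refine ⟨⟨SU2.homologyThreeEquiv⟩, fun p hp => ?_, SU2.subsingleton_homology_five, fun p hp => ?_⟩
  · have hc : ∀ X, p.1 * p.2 * X = X * (p.1 * p.2) := by
      by_contra! hc
      have := SU2.le_dim_of_not_central hc hp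
      omega
    have hb := SU2.map_classFst_bijective hc 3
    refine ⟨Homology.exists_isFundamentalClass ((LinearEquiv.ofBijective _ hb).toAddEquiv.trans
      SU2.homologyThreeEquiv.toAddEquiv), fun c h => ?_⟩
    -- The first projection is an isomorphism on $H_3$, so it sends the fundamental class to a
    -- generator.
    have key := fun φ => (h.map_of_bijective hb).eq_one_or_neg_one φ
    have hfst : Homology.map 3 ContinuousMap.fst (Homology.map 3 (incl (twistedClass p)) c) =
        Homology.map 3 (SU2.classFst p) c := Homology.map_map _ _ _
    refine ⟨fun h0 => ?_, fun φ => ?_⟩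
    · have := key SU2.homologyThreeEquiv
      rw [← hfst, h0, map_zero, map_zero] at this
      omega
    · rw [SU2.map_snd_class hc, hfst, map_neg]
      have := key φ
      omega
  · have hc : ∃ X, p.1 * p.2 * X ≠ X * (p.1 * p.2) := by
      by_contra! hc
      have := SU2.dim_le_of_central hc hp
      omega
    exact ⟨Homology.exists_isFundamentalClass (SU2.classHomologyFiveEquiv hc),
      fun c _ => @Subsingleton.elim _ SU2.subsingleton_homology_five _ _, SU2.not_nullhomotopic p⟩
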